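/- **Setting.** Let $d,m,J\in\mathbb N$, $\mathcal I=\{(k,l)\in\{1,\dots,m\}^2:k<l\}$, let $x_0\in\mathbb R^d$, and let $\Phi:\mathbb R^d\times\mathbb R^m\times\mathbb R^{\mathcal I}\to\mathbb R^d$ and $f:\mathbb R^d\to\mathbb R$ be measurable. Let $\xi_j^i$, $V_j^{kl}$ ($1\le j\le J$, $1\le i\le m$, $(k,l)\in\mathcal I$) be mutually independent with $\mathbb P(\xi_j^i=\pm\sqrt3)=\frac16$, $\mathbb P(\xi_j^i=0)=\frac23$, $\mathbb P(V_j^{kl}=\pm1)=\frac12$, and set $X_0=x_0$, $X_j=\Phi(X_{j-1},\xi_j,V_j)$ for $j=1,\dots,J$. Let $\mathbb P_j$ be the distribution of $X_j$. Conditional expectations given $X_j=x$ are understood, for every $x\in\mathbb R^d$, as expectations for the scheme started in $x$ at step $j$. Put $H_0(x)=1$, $H_1(x)=x$, $H_2(x)=\frac{x^2-1}{\sqrt2}$ and, for $j\in\{1,\dots,J\}$, $y\in\{-\sqrt3,0,\sqrt3\}^m$, $z\in\{-1,1\}^{\mathcal I}$ and $(o,r)\in\{0,1,2\}^m\times\{0,1\}^{\mathcal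 I}$ with $(o,r)\neq(0,0)$, $$q_j(x)=\mathbb E[f(X_J)\mid X_j=x],\qquad h_{j,y,z}(x)=q_j(\Phi(x,y,z)),$$ $$a_{j,o,r}(x)=\mathbb E\Bigl[f(X_J)\prod_{i=1}^m H_{o_i}(\xi_j^i)\prod_{(k,l)\in\mathcal I}(V_j^{kl})^{r_{kl}}\Bigm|X_{j-1}=x\Bigr],$$ $$p_m(y)=\frac{4^{\#\{i:\,y_i=0\}}}{6^m\,2^{m(m-1)/2}},\qquad c_m=3^m2^{m(m-1)/2},$$ $$C_{m,o}=\sum_{y\in\{-\sqrt3,0,\sqrt3\}^m}c_m2^{m(m-1)/2}\Bigl[p_m(y)\prod_{i=1}^mH_{o_i}(y_i)\Bigr]^2 .$$ **Assumptions.** Let $K\ge1$ and $N\ge1$ be integers and let $\psi_1,\dots,\psi_K:\mathbb R^d\to\mathbb R$ be measurable. (A1) There is a constant $A>0$ with $\sup_{x\in\mathbb R^d}|h_{j,y,z}(x)|\le A$ for all $j,y,z$. (A2) There are constants $\kappa>0$ and $C_\kappa>0$ such that, for all $j,y,z$, $$\inf_{g\in\mathrm{span}(\psi_1,\dots,\psi_K)}\int_{\mathbb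 R^d}(h_{j,y,z}-g)^2\,d\mathbb P_{j-1}\le\frac{C_\kappa}{K^\kappa}.$$ (A3) Let $(X^{(n)},\xi^{(n)},V^{(n)})$, $n=1,\dots,N$, be independent copies of the path $X$ together with its noise (the training paths). For each $j,y,z$ let $\hat h_{j,y,z}=\alpha_1\psi_1+\dots+\alpha_K\psi_K$, where $\alpha\in\mathbb R^K$ is random and minimises over $\beta\in\mathbb R^K$ the sum $$\sum_{n:\ \xi_j^{(n)}=y,\ V_j^{(n)}=z}\Bigl(q_j(X_j^{(n)})-\sum_{k=1}^K\beta_k\psi_k(X_{j-1}^{(n)})\Bigr)^2,$$ and let $\tilde h_{j,y,z}=T_A\hat h_{j,y,z}$ be its truncation, where $T_At=t$ if $|t|\le A$ and $T_At=A\,\mathrm{sgn}\,t$ otherwise. Define the estimates $$\tilde a_{j,o,r}(x)=\sum_{y\in\{-\sqrt3,0,\sqrt3\}^m}\ \sum_{z\in\{-1,1\}^{\mathcal I}}\Bigl[p_m(y)\prod_{i=1}^mH_{o_i}(y_i)\prod_{(k,l)\in\mathcal I}z_{kl}^{r_{kl}}\Bigr]\tilde h_{j,y,z}(x).$$ **Claim.**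 There is a universal constant $\tilde c>0$ (independent of all the objects above) such that, under (A1)–(A3), for all $j\in\{1,\dots,J\}$ and all $(o,r)\neq(0,0)$, $$\mathbb E\,\|\tilde a_{j,o,r}-a_{j,o,r}\|^2_{L^2(\mathbb P_{j-1})}\le c_m\tilde c\,A^2(\log N+1)\frac KN+\frac{8\,C_\kappa}{K^\kappa}\,C_{m,o},$$ where the expectation is over the training paths. -/

import Mathlib

open MeasureTheory ProbabilityTheory

namespace SRCV

noncomputable section

/-- The index set `{(k, l) : k < l}`. -/
abbrev Pairs (m : ℕ) : Type := {p : Fin m × Fin m // p.1 < p.2}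

/-- The finite set `{-√3, 0, √3}^m` of possible values of `ξ_j`. -/
def valuesXi (m : ℕ) : Finset (Fin m → ℝ) :=
  Fintype.piFinset fun _ => {-√3, 0, √3}

/-- The finite set `{-1, 1}^(pairs)` of possible values of `V_j`. -/
def valuesV (m : ℕ) : Finset (Pairs m → ℝ) :=
  Fintype.piFinset fun _ => {-1, 1}

/-- `H_0 = 1`, `H_1(x) = x`, `H_2(x) = (x² - 1) / √2`. -/
def hermite (n : Fin 3) (x : ℝ) : ℝ :=
  if n = 0 then 1 else if n = 1 then x else (x ^ 2 - 1) / √2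

/-- `∏_i H_{o_i}(y_i)`. -/
def hermiteProd {m : ℕ} (o : Fin m → Fin 3) (y : Fin m → ℝ) : ℝ :=
  ∏ i, hermite (o i) (y i)

/-- `∏_{k<l} z_{kl}^{r_{kl}}`. -/
def signProd {m : ℕ} (r : Pairs m → Fin 2) (z : Pairs m → ℝ) : ℝ :=
  ∏ p, z p ^ (r p : ℕ)

/-- The set of all `(o, r)` that do not vanish identically. -/
def indexU (m : ℕ) : Set ((Fin m → Fin 3) × (Pairs m → Fin 2)) :=
  {u | (∃ i, u.1 i ≠ 0) ∨ ∃ p, u.2 p ≠ 0}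

/-- `p_m(y) = 4^{#{i : y_i = 0}} / (6^m 2^{m(m-1)/2})`. -/
def prob {m : ℕ} (y : Fin m → ℝ) : ℝ :=
  (4 : ℝ) ^ (Finset.univ.filter fun i => y i = 0).card /
    ((6 : ℝ) ^ m * (2 : ℝ) ^ (m * (m - 1) / 2))

/-- `c_m = 3^m 2^{m(m-1)/2}`, the number of possible values of `(ξ_j, V_j)`. -/
def cConst (m : ℕ) : ℝ := (3 : ℝ) ^ m * (2 : ℝ) ^ (m * (m - 1) / 2)

/-- `C_{m,o} = ∑_y c_m 2^{m(m-1)/2} [p_m(y) ∏_i H_{o_i}(y_i)]²`. -/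
def cConstO {m : ℕ} (o : Fin m → Fin 3) : ℝ :=
  ∑ y ∈ valuesXi m,
    cConst m * (2 : ℝ) ^ (m * (m - 1) / 2) * (prob y * hermiteProd o y) ^ 2

/-- Random vectors `ξ_j ∈ ℝ^m` and `V_j ∈ ℝ^(pairs)`; only `j = 1, …, J` matter. -/
structure Noise (Ω : Type*) (m : ℕ) where
  xi : ℕ → Ω → Fin m → ℝ
  V : ℕ → Ω → Pairs m → ℝ

/-- The distributional requirements on the noise of a weak scheme of order two with `J` steps:
all the coordinates of all the `ξ_j` and `V_j`, `j = 1, …, J`, are mutually independent, with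
`P(ξ_j^i = ±√3) = 1/6`, `P(ξ_j^i = 0) = 2/3`, `P(V_j^{kl} = ±1) = 1/2`. -/
structure Noise.IsOrderTwo {Ω : Type*} [MeasurableSpace Ω] {m : ℕ} (ν : Noise Ω m) (J : ℕ)
    (P : Measure Ω) : Prop where
  measurable_xi : ∀ j ∈ Finset.Icc 1 J, Measurable (ν.xi j)
  measurable_V : ∀ j ∈ Finset.Icc 1 J, Measurable (ν.V j)
  xi_pos : ∀ j ∈ Finset.Icc 1 J, ∀ i, P {ω | ν.xi j ω i = √3} = 1 / 6
  xi_neg : ∀ j ∈ Finset.Icc 1 J, ∀ i, P {ω | ν.xi j ω i = -√3} = 1 / 6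
  xi_zero : ∀ j ∈ Finset.Icc 1 J, ∀ i, P {ω | ν.xi j ω i = 0} = 2 / 3
  V_pos : ∀ j ∈ Finset.Icc 1 J, ∀ p, P {ω | ν.V j ω p = 1} = 1 / 2
  V_neg : ∀ j ∈ Finset.Icc 1 J, ∀ p, P {ω | ν.V j ω p = -1} = 1 / 2
  indep : iIndepFun
    (fun (c : Finset.Icc 1 J × (Fin m ⊕ Pairs m)) (ω : Ω) =>
      Sum.elim (ν.xi c.1 ω) (ν.V c.1 ω) c.2) P

/-- A discretisation scheme in `ℝ^d` driven by an `m`-dimensional noise, with `J` time steps,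
starting point `x₀`, one-step map `Φ = Φ_Δ` and payoff `f`. -/
structure Scheme (d m : ℕ) where
  J : ℕ
  x₀ : Fin d → ℝ
  Φ : (Fin d → ℝ) → (Fin m → ℝ) → (Pairs m → ℝ) → (Fin d → ℝ)
  f : (Fin d → ℝ) → ℝ
  measurable_Φ : Measurable
    fun u : (Fin d → ℝ) × (Fin m → ℝ) × (Pairs m → ℝ) => Φ u.1 u.2.1 u.2.2
  measurable_f : Measurable f

variable {Ω : Type*} {d m : ℕ}

/-- The position, `n` steps after time `s`, of the scheme that sits in `x` at time `s`. -/
def Scheme.chainFrom (S : Scheme d m) (ν : Noise Ω m) (ω : Ω) (s : ℕ) (x : Fin d → ℝ) :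
    ℕ → (Fin d → ℝ)
  | 0 => x
  | n + 1 => S.Φ (S.chainFrom ν ω s x n) (ν.xi (s + n + 1) ω) (ν.V (s + n + 1) ω)

/-- The scheme `X_{Δ, jΔ}`, started at time `0` in `x₀`. -/
def Scheme.path (S : Scheme d m) (ν : Noise Ω m) (j : ℕ) (ω : Ω) : Fin d → ℝ :=
  S.chainFrom ν ω 0 S.x₀ j

/-- The terminal position `X_{Δ, T}`, given that the scheme sits in `x` at time `s ≤ J`. -/
def Scheme.terminal (S : Scheme d m) (ν : Noise Ω m) (s : ℕ) (x : Fin d → ℝ) (ω : Ω) :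
    Fin d → ℝ :=
  S.chainFrom ν ω s x (S.J - s)

variable [MeasurableSpace Ω]

/-- The distribution `P_{Δ, j}` of `X_{Δ, jΔ}`. -/
def Scheme.law (S : Scheme d m) (ν : Noise Ω m) (P : Measure Ω) (j : ℕ) :
    Measure (Fin d → ℝ) :=
  P.map (S.path ν j)

/-- `q_j(x) = E[f(X_{Δ,T}) | X_{Δ,jΔ} = x]`. -/
def Scheme.q (S : Scheme d m) (ν : Noise Ω m) (P : Measure Ω) (j : ℕ) (x : Fin d → ℝ) : ℝ :=
  ∫ ω, S.f (S.terminal ν j x ω) ∂P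

/-- `h_{j,y,z}(x) = q_j(Φ_Δ(x, y, z))`. -/
def Scheme.h (S : Scheme d m) (ν : Noise Ω m) (P : Measure Ω) (j : ℕ)
    (y : Fin m → ℝ) (z : Pairs m → ℝ) (x : Fin d → ℝ) : ℝ :=
  S.q ν P j (S.Φ x y z)

/-- `a_{j,o,r}(x) =
E[f(X_{Δ,T}) ∏_i H_{o_i}(ξ_j^i) ∏_{k<l} (V_j^{kl})^{r_{kl}} | X_{Δ,(j-1)Δ} = x]`. -/
def Scheme.a (S : Scheme d m) (ν : Noise Ω m) (P : Measure Ω) (j : ℕ)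
    (o : Fin m → Fin 3) (r : Pairs m → Fin 2) (x : Fin d → ℝ) : ℝ :=
  ∫ ω, S.f (S.terminal ν (j - 1) x ω) * hermiteProd o (ν.xi j ω) * signProd r (ν.V j ω) ∂P

/-- Uniform boundedness of all the functions `h_{j,y,z}` by `A`. -/
def Scheme.Bounded (S : Scheme d m) (ν : Noise Ω m) (P : Measure Ω) (A : ℝ) : Prop :=
  ∀ j ∈ Finset.Icc 1 S.J, ∀ y ∈ valuesXi m, ∀ z ∈ valuesV m, ∀ x, |S.h ν P j y z x| ≤ A

/-- All the functions `h_{j,y,z}` are approximated by the span of `ψ_1, …, ψ_K` in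
`L²(P_{Δ,j-1})` with squared error at most `C / K^κ`. -/
def Scheme.WellApproximated (S : Scheme d m) (ν : Noise Ω m) (P : Measure Ω) {K : ℕ}
    (ψ : Fin K → (Fin d → ℝ) → ℝ) (C κ : ℝ) : Prop :=
  ∀ j ∈ Finset.Icc 1 S.J, ∀ y ∈ valuesXi m, ∀ z ∈ valuesV m,
    ⨅ g ∈ Submodule.span ℝ (Set.range ψ),
        ∫⁻ x, ENNReal.ofReal ((S.h ν P j y z x - g x) ^ 2) ∂(S.law ν P (j - 1))
      ≤ ENNReal.ofReal (C / (K : ℝ) ^ κ)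

/-- The noises of `N` independent training paths: each of them has the law of the noise of the
scheme, and they are independent of each other. -/
structure IsTraining {N : ℕ} (τ : Fin N → Noise Ω m) (J : ℕ) (P : Measure Ω) : Prop where
  isOrderTwo : ∀ n, (τ n).IsOrderTwo J P
  indep : iIndepFun
    (fun (n : Fin N) (ω : Ω) (j : Finset.Icc 1 J) => ((τ n).xi j ω, (τ n).V j ω)) P

open Classical in
/-- The training paths with `ξ_j = y` and `V_j = z`. -/
def stratum {N : ℕ} (τ : Fin N → Noise Ω m) (j : ℕ) (y : Fin m → ℝ) (z : Pairs m → ℝ)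
    (ω : Ω) : Finset (Fin N) :=
  Finset.univ.filter fun n => (τ n).xi j ω = y ∧ (τ n).V j ω = z

/-- The linear combination `α_1 ψ_1 + … + α_K ψ_K`. -/
def linComb {K : ℕ} (ψ : Fin K → (Fin d → ℝ) → ℝ) (α : Fin K → ℝ) (x : Fin d → ℝ) : ℝ :=
  ∑ k, α k * ψ k x

/-- The residual sum of squares, over the stratum of `(y, z)` among the training paths, of the
regression of `q_j(X_{Δ,jΔ})` on `ψ_1(X_{Δ,(j-1)Δ}), …, ψ_K(X_{Δ,(j-1)Δ})`. -/
def Scheme.residual (S : Scheme d m) (ν : Noise Ω m) (P : Measure Ω) {K N : ℕ}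
    (ψ : Fin K → (Fin d → ℝ) → ℝ) (τ : Fin N → Noise Ω m) (j : ℕ)
    (y : Fin m → ℝ) (z : Pairs m → ℝ) (ω : Ω) (β : Fin K → ℝ) : ℝ :=
  ∑ n ∈ stratum τ j y z ω,
    (S.q ν P j (S.path (τ n) j ω) - linComb ψ β (S.path (τ n) (j - 1) ω)) ^ 2

/-- `α j y z ω` are (measurable, but otherwise arbitrary) least squares coefficients of the
stratified regressions, for all `j`, `y` and `z`. -/
def Scheme.IsRegression (S : Scheme d m) (ν : Noise Ω m) (P : Measure Ω) {K N : ℕ}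
    (ψ : Fin K → (Fin d → ℝ) → ℝ) (τ : Fin N → Noise Ω m)
    (α : ℕ → (Fin m → ℝ) → (Pairs m → ℝ) → Ω → Fin K → ℝ) : Prop :=
  ∀ j ∈ Finset.Icc 1 S.J, ∀ y ∈ valuesXi m, ∀ z ∈ valuesV m,
    Measurable (α j y z) ∧
    ∀ᵐ ω ∂P, ∀ β : Fin K → ℝ,
      S.residual ν P ψ τ j y z ω (α j y z ω) ≤ S.residual ν P ψ τ j y z ω β

/-- The truncation `T_A`. -/
def truncate (A t : ℝ) : ℝ := if |t| ≤ A then t else A * Real.sign t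

/-- The estimate of `a_{j,o,r}`: the weighted sum of the truncated regression estimates
`T_A (α_1 ψ_1 + … + α_K ψ_K)` of `h_{j,y,z}`, with `α = α j y z ω`. -/
def aEstimate {K : ℕ} (A : ℝ) (ψ : Fin K → (Fin d → ℝ) → ℝ)
    (α : ℕ → (Fin m → ℝ) → (Pairs m → ℝ) → Ω → Fin K → ℝ) (j : ℕ)
    (o : Fin m → Fin 3) (r : Pairs m → Fin 2) (ω : Ω) (x : Fin d → ℝ) : ℝ :=
  ∑ y ∈ valuesXi m, ∑ z ∈ valuesV m,
    prob y * hermiteProd o y * signProd r z * truncate A (linComb ψ (α j y z ω) x)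

end

end SRCV

/-!
Add a fresh point to the data of a least squares regression. If the leverage of this point is at
most `1 / 2`, then its squared prediction error is at most twice the increase of the minimal
residual sum of squares, and that increase is at most twice the squared residual of the point in
the regression on all points. The leverages of all points sum to at most the number `K` of
features, so at most `2 K` of them exceed `1 / 2`; for these, truncation bounds the squared error
by `4 A²`. The `N + 1` points are exchangeable, so the expected squared error at the fresh point
is at most four times the approximation error plus `8 A² K / (N + 1)`; there is no logarithm.

A stratum of the training paths has random size. Replacing the data points outside of the stratum
by `0` turns the stratified regression into one on `N` i.i.d. points, at the price of dividing
`8 A² K / (N + 1)` by the probability `p_m(y)` of the stratum. Finally, `a_{j,o,r}` is the sum of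
the `c_m` functions `h_{j,y,z}` with the weights that occur in its estimate, so by the
Cauchy–Schwarz inequality the squared error is at most `c_m` times the sum of the squared errors
of the summands. The probabilities in the denominators disappear because
`∑ p_m(y) ∏ H_{o_i}(y_i)² = 1`: the `H_0, H_1, H_2` have second moment one under the law of `ξ_j^i`.
-/

namespace SRCV

noncomputable section

section Leverage

variable {ι : Type*} [Fintype ι]

/-- The leverage of the `i`-th observation in a regression whose vectors of fitted values form the
subspace `M`: the `i`-th diagonal entry of the orthogonal projection onto `M`. -/
def leverage [DecidableEq ι] (M : Submodule ℝ (EuclideanSpace ℝ ι)) (i : ι) : ℝ :=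
  ‖M.starProjection (EuclideanSpace.single i 1)‖ ^ 2

lemma sum_leverage [DecidableEq ι] (M : Submodule ℝ (EuclideanSpace ℝ ι)) :
    ∑ i, leverage M i = Module.finrank ℝ M := by
  have hproj : LinearMap.IsProj M (M.starProjection : EuclideanSpace ℝ ι →ₗ[ℝ] _) :=
    ⟨fun x => M.starProjection_apply_mem x,
      fun x hx => Submodule.starProjection_eq_self_iff.mpr hx⟩
  rw [← hproj.trace, LinearMap.trace_eq_sum_inner _ (EuclideanSpace.basisFun ι ℝ)]
  refine Finset.sum_congr rfl fun i _ => ?_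
  have hidem := Submodule.starProjection_eq_self_iff.mpr
    (M.starProjection_apply_mem (EuclideanSpace.single i 1))
  rw [leverage, ← real_inner_self_eq_norm_sq, M.inner_starProjection_left_eq_right, hidem]
  simp

lemma sq_apply_le_leverage_mul [DecidableEq ι] {M : Submodule ℝ (EuclideanSpace ℝ ι)}
    {x : EuclideanSpace ℝ ι} (hx : x ∈ M) (i : ι) : x i ^ 2 ≤ leverage M i * ‖x‖ ^ 2 := by
  have hxi : x i = inner ℝ (M.starProjection (EuclideanSpace.single i 1)) x := by
    rw [M.inner_starProjection_left_eq_right, Submodule.starProjection_eq_self_iff.mpr hx]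
    simp [EuclideanSpace.inner_single_left]
  rw [hxi, leverage, ← mul_pow, ← sq_abs]
  exact pow_le_pow_left₀ (abs_nonneg _) (abs_real_inner_le_norm _ _) 2

lemma card_le_mul_finrank_of_norm_sq_lt (M : Submodule ℝ (EuclideanSpace ℝ ι)) {c : ℝ}
    (hc : 0 ≤ c) (s : Finset ι) (hs : ∀ i ∈ s, ∃ x ∈ M, ‖x‖ ^ 2 < c * x i ^ 2) :
    (s.card : ℝ) ≤ c * Module.finrank ℝ M := by
  classical
  have one_le : ∀ i ∈ s, 1 ≤ c * leverage M i := by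
    intro i hi
    obtain ⟨x, hxM, hx⟩ := hs i hi
    have hlev := mul_le_mul_of_nonneg_left (sq_apply_le_leverage_mul hxM i) hc
    by_contra! hlt
    nlinarith [sq_nonneg ‖x‖]
  calc (s.card : ℝ) = ∑ _i ∈ s, (1 : ℝ) := by simp
    _ ≤ ∑ i ∈ s, c * leverage M i := Finset.sum_le_sum one_le
    _ ≤ ∑ i, c * leverage M i :=
      Finset.sum_le_sum_of_subset_of_nonneg (Finset.subset_univ s)
        fun i _ _ => mul_nonneg hc (sq_nonneg _)
    _ = c * Module.finrank ℝ M := by rw [← Finset.mul_sum, sum_leverage]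

end Leverage

section LeastSquares

variable {ι κ : Type*} [Fintype ι] [Fintype κ]

/-- The residual sum of squares of the coefficients `β` on the data `D`, whose `i`-th entry
consists of a vector of features and a response. -/
def rss (D : ι → (κ → ℝ) × ℝ) (β : κ → ℝ) : ℝ :=
  ∑ i, ((D i).2 - β ⬝ᵥ (D i).1) ^ 2

/-- The minimal residual sum of squares of the data `D`. -/
def minRss (D : ι → (κ → ℝ) × ℝ) : ℝ := ⨅ β, rss D β

/-- `β` is a least squares fit of the data `D`; it need not be unique. -/
def IsLeastSquares (D : ι → (κ → ℝ) × ℝ) (β : κ → ℝ) : Prop :=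
  ∀ γ, rss D β ≤ rss D γ

/-- The linear map that sends coefficients to the vector of fitted values. -/
def fittedMap (φ : ι → κ → ℝ) : (κ → ℝ) →ₗ[ℝ] EuclideanSpace ℝ ι where
  toFun β := WithLp.toLp 2 fun i => β ⬝ᵥ φ i
  map_add' a b := by ext i; simp [add_dotProduct]
  map_smul' a b := by ext i; simp [smul_dotProduct]

lemma norm_sq_fittedMap (φ : ι → κ → ℝ) (β : κ → ℝ) :
    ‖fittedMap φ β‖ ^ 2 = ∑ i, (β ⬝ᵥ φ i) ^ 2 := by
  simp [EuclideanSpace.norm_sq_eq, fittedMap]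

lemma card_le_two_mul_of_sum_sq_lt (φ : ι → κ → ℝ) (s : Finset ι)
    (hs : ∀ i ∈ s, ∃ β : κ → ℝ, ∑ j, (β ⬝ᵥ φ j) ^ 2 < 2 * (β ⬝ᵥ φ i) ^ 2) :
    (s.card : ℝ) ≤ 2 * Fintype.card κ := by
  classical
  have hrank : Module.finrank ℝ (LinearMap.range (fittedMap φ)) ≤ Fintype.card κ := by
    simpa using LinearMap.finrank_range_le (fittedMap φ)
  have hcard := card_le_mul_finrank_of_norm_sq_lt (LinearMap.range (fittedMap φ)) zero_le_two s
    fun i hi => by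
      obtain ⟨β, hβ⟩ := hs i hi
      exact ⟨fittedMap φ β, ⟨β, rfl⟩, (norm_sq_fittedMap φ β).trans_lt hβ⟩
  exact hcard.trans (by gcongr)

lemma rss_nonneg (D : ι → (κ → ℝ) × ℝ) (β : κ → ℝ) : 0 ≤ rss D β :=
  Finset.sum_nonneg fun _ _ => sq_nonneg _

lemma rss_add (D : ι → (κ → ℝ) × ℝ) (β γ : κ → ℝ) :
    rss D (β + γ) = rss D β - 2 * ∑ i, ((D i).2 - β ⬝ᵥ (D i).1) * (γ ⬝ᵥ (D i).1)
      + ∑ i, (γ ⬝ᵥ (D i).1) ^ 2 := by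
  simp only [rss, Finset.mul_sum, ← Finset.sum_add_distrib, ← Finset.sum_sub_distrib]
  refine Finset.sum_congr rfl fun i _ => ?_
  rw [add_dotProduct]
  ring

lemma IsLeastSquares.minRss_eq {D : ι → (κ → ℝ) × ℝ} {β : κ → ℝ} (hβ : IsLeastSquares D β) :
    minRss D = rss D β :=
  le_antisymm (ciInf_le ⟨0, Set.forall_mem_range.mpr (rss_nonneg D)⟩ β) (le_ciInf hβ)

lemma IsLeastSquares.normal_equations {D : ι → (κ → ℝ) × ℝ} {β : κ → ℝ}
    (hβ : IsLeastSquares D β) (γ : κ → ℝ) :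
    ∑ i, ((D i).2 - β ⬝ᵥ (D i).1) * (γ ⬝ᵥ (D i).1) = 0 := by
  set S := ∑ i, ((D i).2 - β ⬝ᵥ (D i).1) * (γ ⬝ᵥ (D i).1) with hS
  have hquad : ∀ t : ℝ, 0 ≤ (∑ i, (γ ⬝ᵥ (D i).1) ^ 2) * (t * t) + -2 * S * t + 0 := by
    intro t
    have hmin := hβ (β + t • γ)
    simp only [rss_add, smul_dotProduct, smul_eq_mul, mul_left_comm _ t, mul_pow,
      ← Finset.mul_sum, ← hS] at hmin
    linarith
  have hdiscrim := discrim_le_zero hquad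
  simp only [discrim, mul_zero, sub_zero] at hdiscrim
  nlinarith

lemma isLeastSquares_of_normal_equations {D : ι → (κ → ℝ) × ℝ} {β : κ → ℝ}
    (hβ : ∀ γ : κ → ℝ, ∑ i, ((D i).2 - β ⬝ᵥ (D i).1) * (γ ⬝ᵥ (D i).1) = 0) :
    IsLeastSquares D β := by
  intro γ
  rw [← add_sub_cancel β γ, rss_add, hβ, mul_zero, sub_zero]
  exact le_add_of_nonneg_right (Finset.sum_nonneg fun _ _ => sq_nonneg _)

lemma exists_isLeastSquares (D : ι → (κ → ℝ) × ℝ) : ∃ β, IsLeastSquares D β := by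
  let u : EuclideanSpace ℝ ι := WithLp.toLp 2 fun i => (D i).2
  let M := LinearMap.range (fittedMap fun i => (D i).1)
  obtain ⟨β, hβ⟩ : M.starProjection u ∈ M := M.starProjection_apply_mem u
  refine ⟨β, isLeastSquares_of_normal_equations fun γ => ?_⟩
  have horth := M.starProjection_inner_eq_zero u _ ⟨γ, rfl⟩
  rw [← hβ] at horth
  simpa [u, fittedMap, PiLp.inner_apply, mul_comm] using horth

lemma IsLeastSquares.rss_eq_add {D : ι → (κ → ℝ) × ℝ} {β : κ → ℝ} (hβ : IsLeastSquares D β)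
    (γ : κ → ℝ) : rss D γ = rss D β + ∑ i, ((γ - β) ⬝ᵥ (D i).1) ^ 2 := by
  rw [← add_sub_cancel β γ, rss_add, hβ.normal_equations, add_sub_cancel, mul_zero, sub_zero]

end LeastSquares

section LeaveOneOut

variable {κ : Type*} [Fintype κ] {n : ℕ}

lemma rss_cons (w : (κ → ℝ) × ℝ) (D : Fin n → (κ → ℝ) × ℝ) (β : κ → ℝ) :
    rss (Fin.cons w D : Fin (n + 1) → _) β = (w.2 - β ⬝ᵥ w.1) ^ 2 + rss D β :=
  Fin.sum_univ_succ _

lemma rss_cons_removeNth (D : Fin (n + 1) → (κ → ℝ) × ℝ) (i : Fin (n + 1)) :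
    rss (Fin.cons (D i) (i.removeNth D) : Fin (n + 1) → _) = rss D := by
  funext β
  exact (rss_cons _ _ β).trans
    (Fin.sum_univ_succAbove (fun j => ((D j).2 - β ⬝ᵥ (D j).1) ^ 2) i).symm

lemma IsLeastSquares.sum_sq_sub_eq {w : (κ → ℝ) × ℝ} {D : Fin n → (κ → ℝ) × ℝ} {β v : κ → ℝ}
    (hβ : IsLeastSquares D β) (hv : IsLeastSquares (Fin.cons w D : Fin (n + 1) → _) v) :
    ∑ j, ((v - β) ⬝ᵥ (D j).1) ^ 2 = (w.2 - v ⬝ᵥ w.1) * ((v - β) ⬝ᵥ w.1) := by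
  have hnormal := hv.normal_equations (v - β)
  simp only [Fin.sum_univ_succ, Fin.cons_zero, Fin.cons_succ] at hnormal
  have hsub : ∑ j, ((v - β) ⬝ᵥ (D j).1) ^ 2 =
      ∑ j, ((D j).2 - β ⬝ᵥ (D j).1) * ((v - β) ⬝ᵥ (D j).1)
        - ∑ j, ((D j).2 - v ⬝ᵥ (D j).1) * ((v - β) ⬝ᵥ (D j).1) := by
    rw [← Finset.sum_sub_distrib]
    refine Finset.sum_congr rfl fun j _ => ?_
    rw [sub_dotProduct]
    ring
  rw [hsub, hβ.normal_equations]
  linarith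

lemma IsLeastSquares.minRss_cons_sub {w : (κ → ℝ) × ℝ} {D : Fin n → (κ → ℝ) × ℝ} {β v : κ → ℝ}
    (hβ : IsLeastSquares D β) (hv : IsLeastSquares (Fin.cons w D : Fin (n + 1) → _) v) :
    minRss (Fin.cons w D : Fin (n + 1) → _) - minRss D =
      (w.2 - v ⬝ᵥ w.1) * (w.2 - β ⬝ᵥ w.1) := by
  rw [hv.minRss_eq, hβ.minRss_eq, rss_cons, hβ.rss_eq_add v, hβ.sum_sq_sub_eq hv, sub_dotProduct]
  ring

/-- The data point `w` has leverage at most `1 / 2` when it is added to the data `D`. -/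
def LowLeverage (w : (κ → ℝ) × ℝ) (D : Fin n → (κ → ℝ) × ℝ) : Prop :=
  ∀ β : κ → ℝ, (β ⬝ᵥ w.1) ^ 2 ≤ ∑ j, (β ⬝ᵥ (D j).1) ^ 2

lemma card_le_of_not_lowLeverage (D : Fin (n + 1) → (κ → ℝ) × ℝ) (s : Finset (Fin (n + 1)))
    (hs : ∀ i ∈ s, ¬ LowLeverage (D i) (i.removeNth D)) :
    (s.card : ℝ) ≤ 2 * Fintype.card κ := by
  refine card_le_two_mul_of_sum_sq_lt (fun i => (D i).1) s fun i hi => ?_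
  obtain ⟨β, hβ⟩ := not_forall.mp (hs i hi)
  refine ⟨β, ?_⟩
  rw [Fin.sum_univ_succAbove _ i]
  simp only [Fin.removeNth_apply, not_le] at hβ
  linarith

lemma LowLeverage.sq_predictionError_le {w : (κ → ℝ) × ℝ} {D : Fin n → (κ → ℝ) × ℝ}
    (hw : LowLeverage w D) {β : κ → ℝ} (hβ : IsLeastSquares D β) :
    (w.2 - β ⬝ᵥ w.1) ^ 2 ≤ 2 * (minRss (Fin.cons w D : Fin (n + 1) → _) - minRss D) := by
  obtain ⟨v, hv⟩ := exists_isLeastSquares (Fin.cons w D : Fin (n + 1) → _)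
  have hlow := (hw (v - β)).trans_eq (hβ.sum_sq_sub_eq hv)
  rw [hβ.minRss_cons_sub hv]
  rw [sub_dotProduct] at hlow
  nlinarith [sq_nonneg (w.2 - v ⬝ᵥ w.1)]

lemma LowLeverage.minRss_cons_sub_le {w : (κ → ℝ) × ℝ} {D : Fin n → (κ → ℝ) × ℝ}
    (hw : LowLeverage w D) {v : κ → ℝ}
    (hv : IsLeastSquares (Fin.cons w D : Fin (n + 1) → _) v) :
    minRss (Fin.cons w D : Fin (n + 1) → _) - minRss D ≤ 2 * (w.2 - v ⬝ᵥ w.1) ^ 2 := by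
  obtain ⟨β, hβ⟩ := exists_isLeastSquares D
  have hlow := (hw (v - β)).trans_eq (hβ.sum_sq_sub_eq hv)
  rw [hβ.minRss_cons_sub hv]
  rw [sub_dotProduct] at hlow
  nlinarith [sq_nonneg (w.2 - β ⬝ᵥ w.1 - 2 * (w.2 - v ⬝ᵥ w.1))]

lemma abs_truncate_le {A : ℝ} (hA : 0 ≤ A) (t : ℝ) : |truncate A t| ≤ A := by
  unfold truncate
  split_ifs with h
  · exact h
  · have hsign : |Real.sign t| ≤ 1 := by
      obtain h | h | h := Real.sign_apply_eq t <;> simp [h]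
    rw [abs_mul, abs_of_nonneg hA]
    exact mul_le_of_le_one_right hA hsign

lemma sq_truncate_sub_le {A u : ℝ} (hu : |u| ≤ A) (t : ℝ) :
    (truncate A t - u) ^ 2 ≤ (u - t) ^ 2 := by
  have ⟨hlower, hupper⟩ := abs_le.mp hu
  unfold truncate
  split_ifs with h
  · exact (sub_sq_comm t u).le
  · rcases lt_or_ge t 0 with ht | ht
    · rw [abs_of_neg ht] at h
      rw [Real.sign_of_neg ht]
      nlinarith
    · rw [abs_of_nonneg ht] at h
      rw [Real.sign_of_pos (by linarith [abs_nonneg u])]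
      nlinarith

open Classical in
/-- A bound for the squared error at `w` of the truncated least squares prediction from `D`. It is
expressed through minimal residual sums of squares because, unlike least squares fits, these are
evidently measurable functions of the data. -/
def looBound (A : ℝ) (w : (κ → ℝ) × ℝ) (D : Fin n → (κ → ℝ) × ℝ) : ℝ :=
  if LowLeverage w D then 2 * (minRss (Fin.cons w D : Fin (n + 1) → _) - minRss D)
  else 4 * A ^ 2

lemma sq_truncate_sub_le_looBound {A : ℝ} {w : (κ → ℝ) × ℝ} (hA : |w.2| ≤ A)
    {D : Fin n → (κ → ℝ) × ℝ} {β : κ → ℝ} (hβ : IsLeastSquares D β) :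
    (truncate A (β ⬝ᵥ w.1) - w.2) ^ 2 ≤ looBound A w D := by
  unfold looBound
  split_ifs with hlow
  · exact (sq_truncate_sub_le hA _).trans (hlow.sq_predictionError_le hβ)
  · have htrunc := abs_le.mp (abs_truncate_le ((abs_nonneg _).trans hA) (β ⬝ᵥ w.1))
    have hresp := abs_le.mp hA
    nlinarith

lemma looBound_nonneg (A : ℝ) (w : (κ → ℝ) × ℝ) (D : Fin n → (κ → ℝ) × ℝ) :
    0 ≤ looBound A w D := by
  unfold looBound
  split_ifs with hlow
  · obtain ⟨β, hβ⟩ := exists_isLeastSquares D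
    exact (sq_nonneg _).trans (hlow.sq_predictionError_le hβ)
  · positivity

lemma looBound_removeNth_le (A : ℝ) {D : Fin (n + 1) → (κ → ℝ) × ℝ} {v : κ → ℝ}
    (hv : IsLeastSquares D v) (i : Fin (n + 1))
    [Decidable (LowLeverage (D i) (i.removeNth D))] :
    looBound A (D i) (i.removeNth D) ≤ 4 * ((D i).2 - v ⬝ᵥ (D i).1) ^ 2 +
      if LowLeverage (D i) (i.removeNth D) then 0 else 4 * A ^ 2 := by
  unfold looBound
  split_ifs with hlow
  · have := hlow.minRss_cons_sub_le (v := v) (by rwa [IsLeastSquares, rss_cons_removeNth])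
    linarith
  · exact le_add_of_nonneg_left (by positivity)

lemma sum_looBound_le (A : ℝ) (D : Fin (n + 1) → (κ → ℝ) × ℝ) (β : κ → ℝ) :
    ∑ i, looBound A (D i) (i.removeNth D) ≤ 4 * rss D β + 8 * A ^ 2 * Fintype.card κ := by
  classical
  obtain ⟨v, hv⟩ := exists_isLeastSquares D
  have hcard := card_le_of_not_lowLeverage D
    (Finset.univ.filter fun i => ¬ LowLeverage (D i) (i.removeNth D))
    fun i hi => (Finset.mem_filter.mp hi).2
  calc _ ≤ _ := Finset.sum_le_sum fun i _ => looBound_removeNth_le A hv i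
    _ = 4 * rss D v +
        (Finset.univ.filter fun i => ¬ LowLeverage (D i) (i.removeNth D)).card * (4 * A ^ 2) := by
      rw [Finset.sum_add_distrib, ← Finset.mul_sum, rss, Finset.card_filter, Nat.cast_sum,
        Finset.sum_mul]
      simp only [ite_not, Nat.cast_ite, Nat.cast_zero, Nat.cast_one, ite_mul, zero_mul, one_mul]
    _ ≤ 4 * rss D β + 2 * Fintype.card κ * (4 * A ^ 2) := by gcongr; exact hv β
    _ = _ := by ring

end LeaveOneOut

section Risk

variable {κ : Type*} [Fintype κ] {n : ℕ}

@[fun_prop]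
lemma measurable_truncate (A : ℝ) : Measurable (truncate A) := by
  unfold truncate Real.sign
  refine Measurable.ite (measurableSet_le measurable_norm measurable_const) measurable_id ?_
  exact (Measurable.ite measurableSet_Iio measurable_const
    (Measurable.ite measurableSet_Ioi measurable_const measurable_const)).const_mul A

lemma measurable_minRss : Measurable (minRss : (Fin n → (κ → ℝ) × ℝ) → ℝ) := by
  refine UpperSemicontinuous.measurable (upperSemicontinuous_ciInf (f := fun β D => rss D β)
    (fun D => ⟨0, Set.forall_mem_range.mpr (rss_nonneg D)⟩) fun β => ?_)
  refine Continuous.upperSemicontinuous ?_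
  unfold rss
  fun_prop

lemma measurableSet_lowLeverage :
    MeasurableSet {q : ((κ → ℝ) × ℝ) × (Fin n → (κ → ℝ) × ℝ) | LowLeverage q.1 q.2} := by
  refine IsClosed.measurableSet ?_
  simp only [LowLeverage, Set.ofPred_forall]
  exact isClosed_iInter fun β => isClosed_le (by fun_prop) (by fun_prop)

lemma measurable_looBound (A : ℝ) :
    Measurable fun q : ((κ → ℝ) × ℝ) × (Fin n → (κ → ℝ) × ℝ) => looBound A q.1 q.2 := by
  classical
  have hcons : Measurable fun q : ((κ → ℝ) × ℝ) × (Fin n → (κ → ℝ) × ℝ) =>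
      (Fin.cons q.1 q.2 : Fin (n + 1) → (κ → ℝ) × ℝ) :=
    measurable_pi_iff.mpr <| Fin.cases measurable_fst
      fun j => (measurable_pi_apply j).comp measurable_snd
  exact Measurable.ite measurableSet_lowLeverage
    (((measurable_minRss.comp hcons).sub (measurable_minRss.comp measurable_snd)).const_mul 2)
    measurable_const

lemma lintegral_pi_removeNth {E : Type*} [MeasurableSpace E] (μ : Measure E)
    [IsProbabilityMeasure μ] {G : E × (Fin n → E) → ENNReal} (hG : Measurable G)
    (i : Fin (n + 1)) :
    ∫⁻ D : Fin (n + 1) → E, G (D i, i.removeNth D) ∂(Measure.pi fun _ => μ) =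
      ∫⁻ D, ∫⁻ w, G (w, D) ∂μ ∂(Measure.pi fun _ => μ) :=
  ((measurePreserving_piFinSuccAbove (fun _ : Fin (n + 1) => μ) i).lintegral_comp hG).trans
    (lintegral_prod_symm _ hG.aemeasurable)

lemma lintegral_rss {ι : Type*} [Fintype ι] (μ : Measure ((κ → ℝ) × ℝ)) [IsProbabilityMeasure μ]
    (β : κ → ℝ) :
    ∫⁻ D : ι → (κ → ℝ) × ℝ, ENNReal.ofReal (rss D β) ∂(Measure.pi fun _ => μ) =
      Fintype.card ι * ∫⁻ w, ENNReal.ofReal ((w.2 - β ⬝ᵥ w.1) ^ 2) ∂μ := by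
  have hsq : Measurable fun w : (κ → ℝ) × ℝ => ENNReal.ofReal ((w.2 - β ⬝ᵥ w.1) ^ 2) := by
    fun_prop
  have heval (i : ι) : ∫⁻ D : ι → (κ → ℝ) × ℝ, ENNReal.ofReal (((D i).2 - β ⬝ᵥ (D i).1) ^ 2)
      ∂(Measure.pi fun _ => μ) = ∫⁻ w, ENNReal.ofReal ((w.2 - β ⬝ᵥ w.1) ^ 2) ∂μ :=
    (measurePreserving_eval (fun _ : ι => μ) i).lintegral_comp hsq
  simp only [rss, ENNReal.ofReal_sum_of_nonneg fun _ _ => sq_nonneg _]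
  rw [lintegral_finsetSum _ fun i _ => by fun_prop, Finset.sum_congr rfl fun i _ => heval i,
    Finset.sum_const, Finset.card_univ, nsmul_eq_mul]

-- The `n + 1` points obtained by adding a fresh point to the data are exchangeable.
lemma succ_mul_lintegral_looBound_le (μ : Measure ((κ → ℝ) × ℝ)) [IsProbabilityMeasure μ] (A : ℝ)
    (β : κ → ℝ) :
    (n + 1 : ENNReal) * ∫⁻ D : Fin n → (κ → ℝ) × ℝ, ∫⁻ w, ENNReal.ofReal (looBound A w D) ∂μ
        ∂(Measure.pi fun _ => μ) ≤
      (n + 1) * (4 * ∫⁻ w, ENNReal.ofReal ((w.2 - β ⬝ᵥ w.1) ^ 2) ∂μ) +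
        ENNReal.ofReal (8 * A ^ 2 * Fintype.card κ) := by
  have hloo : Measurable fun q : ((κ → ℝ) × ℝ) × (Fin n → (κ → ℝ) × ℝ) =>
      ENNReal.ofReal (looBound A q.1 q.2) := (measurable_looBound A).ennreal_ofReal
  have hsplit (i : Fin (n + 1)) : Measurable fun D : Fin (n + 1) → (κ → ℝ) × ℝ =>
      (D i, i.removeNth D) :=
    (measurable_pi_apply i).prodMk (measurable_pi_iff.mpr fun _ => measurable_pi_apply _)
  calc _ = ∑ i : Fin (n + 1), ∫⁻ D : Fin (n + 1) → (κ → ℝ) × ℝ,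
          ENNReal.ofReal (looBound A (D i) (i.removeNth D)) ∂(Measure.pi fun _ => μ) := by
        simp [lintegral_pi_removeNth μ hloo]
    _ = ∫⁻ D : Fin (n + 1) → (κ → ℝ) × ℝ,
          ENNReal.ofReal (∑ i, looBound A (D i) (i.removeNth D)) ∂(Measure.pi fun _ => μ) := by
        simp only [ENNReal.ofReal_sum_of_nonneg fun _ _ => looBound_nonneg A _ _]
        exact (lintegral_finsetSum _ fun i _ => hloo.comp (hsplit i)).symm
    _ ≤ ∫⁻ D : Fin (n + 1) → (κ → ℝ) × ℝ,
          4 * ENNReal.ofReal (rss D β) + ENNReal.ofReal (8 * A ^ 2 * Fintype.card κ)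
          ∂(Measure.pi fun _ => μ) := by
        refine lintegral_mono fun D => ?_
        rw [← ENNReal.ofReal_ofNat, ← ENNReal.ofReal_mul zero_le_four,
          ← ENNReal.ofReal_add (mul_nonneg zero_le_four (rss_nonneg D β)) (by positivity)]
        exact ENNReal.ofReal_le_ofReal (sum_looBound_le A D β)
    _ = _ := by
        rw [lintegral_add_right _ measurable_const, lintegral_const_mul' _ _ (by simp),
          lintegral_rss]
        simp [mul_left_comm]

lemma lintegral_looBound_le (μ : Measure ((κ → ℝ) × ℝ)) [IsProbabilityMeasure μ] (A : ℝ)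
    (β : κ → ℝ) :
    ∫⁻ D : Fin n → (κ → ℝ) × ℝ, ∫⁻ w, ENNReal.ofReal (looBound A w D) ∂μ
        ∂(Measure.pi fun _ => μ) ≤
      4 * ∫⁻ w, ENNReal.ofReal ((w.2 - β ⬝ᵥ w.1) ^ 2) ∂μ +
        ENNReal.ofReal (8 * A ^ 2 * Fintype.card κ) / (n + 1) := by
  have hn_zero : (n + 1 : ENNReal) ≠ 0 := by simp
  have hn_top : (n + 1 : ENNReal) ≠ ⊤ := by finiteness
  rw [← ENNReal.mul_le_mul_iff_right hn_zero hn_top, mul_add,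
    ENNReal.mul_div_cancel hn_zero hn_top]
  exact succ_mul_lintegral_looBound_le μ A β

theorem lintegral_sq_truncate_leastSquares_sub_le {Ω : Type*} [MeasurableSpace Ω] {P : Measure Ω}
    {W : Fin n → Ω → (κ → ℝ) × ℝ} (hW : ∀ i, Measurable (W i)) (hindep : iIndepFun W P)
    {μ : Measure ((κ → ℝ) × ℝ)} [IsProbabilityMeasure μ] (hlaw : ∀ i, P.map (W i) = μ)
    {A : ℝ} (hA : ∀ᵐ w ∂μ, |w.2| ≤ A) {b : Ω → κ → ℝ}
    (hb : ∀ᵐ ω ∂P, IsLeastSquares (fun i => W i ω) (b ω)) (β : κ → ℝ) :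
    ∫⁻ ω, ∫⁻ w, ENNReal.ofReal ((truncate A (b ω ⬝ᵥ w.1) - w.2) ^ 2) ∂μ ∂P ≤
      4 * ∫⁻ w, ENNReal.ofReal ((w.2 - β ⬝ᵥ w.1) ^ 2) ∂μ +
        ENNReal.ofReal (8 * A ^ 2 * Fintype.card κ) / (n + 1) := by
  refine le_trans ?_ (lintegral_looBound_le μ A β)
  have hloo : Measurable fun q : ((κ → ℝ) × ℝ) × (Fin n → (κ → ℝ) × ℝ) =>
      ENNReal.ofReal (looBound A q.1 q.2) := (measurable_looBound A).ennreal_ofReal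
  have hjoint : P.map (fun ω i => W i ω) = Measure.pi fun _ => μ := by
    have := hindep.isProbabilityMeasure
    simpa only [hlaw] using
      (iIndepFun_iff_map_fun_eq_pi_map fun i => (hW i).aemeasurable).mp hindep
  rw [← hjoint, lintegral_map hloo.lintegral_prod_left' (measurable_pi_iff.mpr hW)]
  refine lintegral_mono_ae ?_
  filter_upwards [hb] with ω hω
  refine lintegral_mono_ae ?_
  filter_upwards [hA] with w hw
  exact ENNReal.ofReal_le_ofReal (sq_truncate_sub_le_looBound hw hω)

end Risk

section Stratum

variable {E F κ : Type*} [MeasurableSpace E] [MeasurableSpace F] [MeasurableSingletonClass F]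

open Classical in
/-- The data point of the regression of `h` on `ψ` over the stratum of the label `t`. Points outside
of the stratum are replaced by `0`, which leaves the residual sum of squares unchanged and keeps
the number of data points deterministic. -/
def stratumPoint (ψ : κ → E → ℝ) (h : E → ℝ) (t : F) (u : E × F) : (κ → ℝ) × ℝ :=
  if u.2 = t then (fun k => ψ k u.1, h u.1) else 0

variable {ψ : κ → E → ℝ} {h : E → ℝ} {t : F}

lemma measurable_stratumPoint (hψ : ∀ k, Measurable (ψ k)) (hh : Measurable h) (t : F) :
    Measurable (stratumPoint ψ h t) := by
  classical
  exact Measurable.ite ((measurableSet_singleton t).preimage measurable_snd)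
    ((measurable_pi_iff.mpr fun k => (hψ k).comp measurable_fst).prodMk (hh.comp measurable_fst))
    measurable_const

lemma lintegral_map_stratumPoint (hψ : ∀ k, Measurable (ψ k)) (hh : Measurable h) (t : F)
    (π : Measure E) (ρ : Measure F) [IsFiniteMeasure ρ] {G : (κ → ℝ) × ℝ → ENNReal}
    (hG : Measurable G) (hG0 : G 0 = 0) :
    ∫⁻ w, G w ∂((π.prod ρ).map (stratumPoint ψ h t)) =
      ρ {t} * ∫⁻ x, G (fun k => ψ k x, h x) ∂π := by
  classical
  have hpoint := measurable_stratumPoint hψ hh t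
  rw [lintegral_map hG hpoint,
    lintegral_prod (fun u => G (stratumPoint ψ h t u)) (hG.comp hpoint).aemeasurable,
    ← lintegral_const_mul' _ _ (measure_ne_top ρ _)]
  refine lintegral_congr fun x => ?_
  have hindicator : (fun s => G (stratumPoint ψ h t (x, s))) =
      Set.indicator {t} fun _ => G (fun k => ψ k x, h x) := by
    funext s
    by_cases hs : s = t <;> simp [stratumPoint, Set.indicator, hs, hG0]
  rw [hindicator, lintegral_indicator_const (measurableSet_singleton t), mul_comm]

variable [Fintype κ] {Ω : Type*} [MeasurableSpace Ω] {P : Measure Ω} {π : Measure E}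
  [IsProbabilityMeasure π] {ρ : Measure F} [IsProbabilityMeasure ρ] {n : ℕ}
  {Z : Fin n → Ω → E × F} {A : ℝ} {b : Ω → κ → ℝ}

lemma mul_lintegral_stratum_le (hψ : ∀ k, Measurable (ψ k)) (hh : Measurable h)
    (hA : ∀ x, |h x| ≤ A) (hZ : ∀ i, Measurable (Z i)) (hindep : iIndepFun Z P)
    (hlaw : ∀ i, P.map (Z i) = π.prod ρ)
    (hb : ∀ᵐ ω ∂P, IsLeastSquares (fun i => stratumPoint ψ h t (Z i ω)) (b ω)) (β : κ → ℝ) :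
    ρ {t} * ∫⁻ ω, ∫⁻ x, ENNReal.ofReal ((truncate A (b ω ⬝ᵥ fun k => ψ k x) - h x) ^ 2) ∂π ∂P ≤
      4 * (ρ {t} * ∫⁻ x, ENNReal.ofReal ((h x - β ⬝ᵥ fun k => ψ k x) ^ 2) ∂π) +
        ENNReal.ofReal (8 * A ^ 2 * Fintype.card κ) / (n + 1) := by
  have hpoint := measurable_stratumPoint hψ hh t
  have := Measure.isProbabilityMeasure_map (μ := π.prod ρ) hpoint.aemeasurable
  have hbdd : ∀ᵐ w ∂((π.prod ρ).map (stratumPoint ψ h t)), |w.2| ≤ A := by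
    refine (ae_map_iff hpoint.aemeasurable
      (measurableSet_le measurable_snd.abs measurable_const)).mpr (.of_forall fun u => ?_)
    unfold stratumPoint
    split_ifs
    · exact hA u.1
    · simpa using (abs_nonneg _).trans (hA u.1)
  have hrisk := lintegral_sq_truncate_leastSquares_sub_le (fun i => hpoint.comp (hZ i))
    (hindep.comp _ fun _ => hpoint)
    (fun i => by rw [← Measure.map_map hpoint (hZ i), hlaw i]) hbdd hb β
  have hestimate (ω : Ω) := lintegral_map_stratumPoint hψ hh t π ρ
    (G := fun w => ENNReal.ofReal ((truncate A (b ω ⬝ᵥ w.1) - w.2) ^ 2)) (by fun_prop)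
    (by simp [truncate])
  have happrox := lintegral_map_stratumPoint hψ hh t π ρ
    (G := fun w => ENNReal.ofReal ((w.2 - β ⬝ᵥ w.1) ^ 2)) (by fun_prop) (by simp)
  simpa only [hestimate, happrox, lintegral_const_mul' _ _ (measure_ne_top ρ _)] using hrisk

theorem lintegral_stratum_le (hψ : ∀ k, Measurable (ψ k)) (hh : Measurable h)
    (hA : ∀ x, |h x| ≤ A) (ht : ρ {t} ≠ 0) (hZ : ∀ i, Measurable (Z i)) (hindep : iIndepFun Z P)
    (hlaw : ∀ i, P.map (Z i) = π.prod ρ)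
    (hb : ∀ᵐ ω ∂P, IsLeastSquares (fun i => stratumPoint ψ h t (Z i ω)) (b ω)) :
    ∫⁻ ω, ∫⁻ x, ENNReal.ofReal ((truncate A (b ω ⬝ᵥ fun k => ψ k x) - h x) ^ 2) ∂π ∂P ≤
      4 * (⨅ g ∈ Submodule.span ℝ (Set.range ψ), ∫⁻ x, ENNReal.ofReal ((h x - g x) ^ 2) ∂π) +
        ENNReal.ofReal (8 * A ^ 2 * Fintype.card κ) / (n + 1) / ρ {t} := by
  simp only [ENNReal.mul_iInf_of_ne four_ne_zero ENNReal.ofNat_ne_top, ENNReal.iInf_add]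
  refine le_iInf₂ fun g hg => ?_
  obtain ⟨β, rfl⟩ := (Submodule.mem_span_range_iff_exists_fun ℝ).mp hg
  have ht_top : ρ {t} ≠ ⊤ := measure_ne_top ρ {t}
  have hβ : (fun x => β ⬝ᵥ fun k => ψ k x) = ∑ k, β k • ψ k := by
    ext x
    simp [dotProduct]
  rw [← ENNReal.mul_le_mul_iff_right ht ht_top, mul_add, ENNReal.mul_div_cancel ht ht_top,
    mul_left_comm, ← hβ]
  exact mul_lintegral_stratum_le hψ hh hA hZ hindep hlaw hb β

end Stratum

section NoiseValues

variable {m : ℕ}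

/-- The possible values `(y, z)` of the noise `(ξ_j, V_j)` of one step. -/
abbrev stepValues (m : ℕ) : Finset ((Fin m → ℝ) × (Pairs m → ℝ)) := valuesXi m ×ˢ valuesV m

/-- The weight of `t ∈ {-√3, 0, √3}` under the law of a coordinate of `ξ_j`; it is the factor by
which that coordinate enters `prob`. -/
def xiProb (t : ℝ) : ℝ := if t = 0 then 2 / 3 else 1 / 6

lemma mem_valuesXi {y : Fin m → ℝ} :
    y ∈ valuesXi m ↔ ∀ i, y i = -√3 ∨ y i = 0 ∨ y i = √3 := by
  simp [valuesXi]

lemma mem_valuesV {z : Pairs m → ℝ} : z ∈ valuesV m ↔ ∀ p, z p = -1 ∨ z p = 1 := by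
  simp [valuesV]

lemma card_pairs (m : ℕ) : Fintype.card (Pairs m) = m * (m - 1) / 2 := by
  rw [Fintype.card_subtype, Finset.card_filter, Fintype.sum_prod_type_right,
    ← Finset.sum_range_id, ← Fin.sum_univ_eq_sum_range (fun i => i)]
  refine Finset.sum_congr rfl fun j _ => ?_
  rw [← Finset.card_filter, Finset.filter_gt_eq_Iio, Fin.card_Iio]

lemma sum_neg_zero_self {M : Type*} [AddCommMonoid M] {a : ℝ} (ha : 0 < a) (g : ℝ → M) :
    ∑ t ∈ {-a, 0, a}, g t = g (-a) + (g 0 + g a) := by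
  rw [Finset.sum_insert, Finset.sum_pair ha.ne]
  simp only [Finset.mem_insert, Finset.mem_singleton, not_or]
  constructor <;> linarith

lemma card_valuesXi (m : ℕ) : (valuesXi m).card = 3 ^ m := by
  have h : ({-√3, 0, √3} : Finset ℝ).card = 3 := by
    rw [Finset.card_eq_sum_ones, sum_neg_zero_self (by positivity)]
    rfl
  simp [valuesXi, h]

lemma card_valuesV (m : ℕ) : (valuesV m).card = 2 ^ (m * (m - 1) / 2) := by
  have h : ({-1, 1} : Finset ℝ).card = 2 := Finset.card_pair (by norm_num)
  simp [valuesV, h, card_pairs]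

lemma card_stepValues (m : ℕ) : ((stepValues m).card : ℝ) = cConst m := by
  rw [Finset.card_product, card_valuesXi, card_valuesV, cConst]
  push_cast
  rfl

lemma xiProb_nonneg (t : ℝ) : 0 ≤ xiProb t := by
  unfold xiProb
  split_ifs <;> norm_num

lemma prob_eq_prod (y : Fin m → ℝ) :
    prob y = (∏ i, xiProb (y i)) * (1 / 2) ^ Fintype.card (Pairs m) := by
  have h (t : ℝ) : xiProb t = (if t = 0 then 4 else 1) / 6 := by
    unfold xiProb
    split_ifs <;> norm_num
  simp only [h, prob, card_pairs, Finset.prod_div_distrib, Finset.prod_ite, Finset.prod_const,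
    Finset.card_univ, Fintype.card_fin, mul_one, div_pow, one_pow]
  rw [div_mul_div_comm, mul_one]

lemma prob_pos (y : Fin m → ℝ) : 0 < prob y := by
  unfold prob
  positivity

lemma sum_xiProb_mul_sq_hermite (o : Fin 3) :
    ∑ t ∈ {-√3, 0, √3}, xiProb t * hermite o t ^ 2 = 1 := by
  have h3 : √3 ^ 2 = 3 := Real.sq_sqrt (by norm_num)
  have h2 : √2 ^ 2 = 2 := Real.sq_sqrt (by norm_num)
  rw [sum_neg_zero_self (by positivity)]
  fin_cases o <;> simp [xiProb, hermite, div_pow, h2, h3] <;> norm_num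

lemma sum_prob_mul_sq_hermiteProd (o : Fin m → Fin 3) :
    ∑ t ∈ stepValues m, prob t.1 * hermiteProd o t.1 ^ 2 = 1 := by
  have hfactor (y : Fin m → ℝ) : ∑ _z ∈ valuesV m, prob y * hermiteProd o y ^ 2 =
      ∏ i, xiProb (y i) * hermite (o i) (y i) ^ 2 := by
    rw [Finset.sum_const, card_valuesV, nsmul_eq_mul, prob_eq_prod, card_pairs, hermiteProd,
      Finset.prod_mul_distrib, Finset.prod_pow, Nat.cast_pow, Nat.cast_ofNat, div_pow, one_pow]
    field_simp
  simp only [Finset.sum_product, hfactor]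
  rw [valuesXi, ← Finset.prod_univ_sum (fun _ => {-√3, 0, √3})
    (fun i t => xiProb t * hermite (o i) t ^ 2)]
  exact Finset.prod_eq_one fun i _ => sum_xiProb_mul_sq_hermite (o i)

lemma sum_prob (m : ℕ) : ∑ t ∈ stepValues m, prob t.1 = 1 := by
  simpa [hermiteProd, hermite] using sum_prob_mul_sq_hermiteProd (0 : Fin m → Fin 3)

lemma sq_signProd (r : Pairs m → Fin 2) {z : Pairs m → ℝ} (hz : z ∈ valuesV m) :
    signProd r z ^ 2 = 1 := by
  rw [signProd, ← Finset.prod_pow]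
  refine Finset.prod_eq_one fun p _ => ?_
  have hp : z p ^ 2 = 1 := sq_eq_one_iff.mpr (mem_valuesV.mp hz p).symm
  rw [pow_right_comm, hp, one_pow]

end NoiseValues

section NoiseLaw

variable {Ω : Type*} {m J j : ℕ}

/-- The noise `(ξ_j, V_j)` of step `j`. -/
def Noise.step (ν : Noise Ω m) (j : ℕ) (ω : Ω) : (Fin m → ℝ) × (Pairs m → ℝ) :=
  (ν.xi j ω, ν.V j ω)

/-- The common law of all the `(ξ_j, V_j)`; a value `(y, z)` has mass `prob y`. -/
def stepLaw (m : ℕ) : Measure ((Fin m → ℝ) × (Pairs m → ℝ)) :=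
  ∑ t ∈ stepValues m, ENNReal.ofReal (prob t.1) • Measure.dirac t

/-- The `σ`-algebra generated by the `(ξ_j, V_j)` with `1 ≤ j ≤ J` and `j ∈ T`. It is written as a
supremum over the scalar coordinates because independence is assumed for these. -/
@[reducible] def Noise.sigma (ν : Noise Ω m) (J : ℕ) (T : Set ℕ) : MeasurableSpace Ω :=
  ⨆ c ∈ {c : Finset.Icc 1 J × (Fin m ⊕ Pairs m) | (c.1 : ℕ) ∈ T},
    MeasurableSpace.comap (fun ω => Sum.elim (ν.xi c.1 ω) (ν.V c.1 ω) c.2) inferInstance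

lemma Noise.measurable_step_sigma (ν : Noise Ω m) {T : Set ℕ} (hj : j ∈ Finset.Icc 1 J)
    (hT : j ∈ T) : Measurable[ν.sigma J T] (ν.step j) := by
  have hcoord (a : Fin m ⊕ Pairs m) :
      Measurable[ν.sigma J T] fun ω => Sum.elim (ν.xi j ω) (ν.V j ω) a :=
    (comap_measurable _).mono (le_iSup₂_of_le (⟨j, hj⟩, a) hT le_rfl) le_rfl
  let _ := ν.sigma J T
  exact (measurable_pi_iff.mpr fun i => hcoord (.inl i)).prodMk
    (measurable_pi_iff.mpr fun p => hcoord (.inr p))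

variable [MeasurableSpace Ω] {P : Measure Ω} {ν : Noise Ω m}

namespace Noise.IsOrderTwo

lemma measurable_step (h : ν.IsOrderTwo J P) (hj : j ∈ Finset.Icc 1 J) :
    Measurable (ν.step j) :=
  (h.measurable_xi j hj).prodMk (h.measurable_V j hj)

lemma indep_sigma (h : ν.IsOrderTwo J P) {T T' : Set ℕ} (hT : Disjoint T T') :
    Indep (ν.sigma J T) (ν.sigma J T') P := by
  refine indep_iSup_of_disjoint (fun c => Measurable.comap_le ?_) h.indep
    (Set.disjoint_left.mpr fun c hc hc' => Set.disjoint_left.mp hT hc hc')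
  obtain ⟨⟨j, hj⟩, i | p⟩ := c
  · exact (measurable_pi_apply i).comp (h.measurable_xi j hj)
  · exact (measurable_pi_apply p).comp (h.measurable_V j hj)

lemma measure_xi_eq (h : ν.IsOrderTwo J P) (hj : j ∈ Finset.Icc 1 J) (i : Fin m) {t : ℝ}
    (ht : t = -√3 ∨ t = 0 ∨ t = √3) :
    P {ω | ν.xi j ω i = t} = ENNReal.ofReal (xiProb t) := by
  rcases ht with rfl | rfl | rfl
  · rw [h.xi_neg j hj, xiProb, if_neg (by simp), ENNReal.ofReal_div_of_pos (by norm_num)]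
    simp
  · rw [h.xi_zero j hj, xiProb, if_pos rfl, ENNReal.ofReal_div_of_pos (by norm_num)]
    simp
  · rw [h.xi_pos j hj, xiProb, if_neg (by simp), ENNReal.ofReal_div_of_pos (by norm_num)]
    simp

lemma measure_V_eq (h : ν.IsOrderTwo J P) (hj : j ∈ Finset.Icc 1 J) (p : Pairs m) {t : ℝ}
    (ht : t = -1 ∨ t = 1) : P {ω | ν.V j ω p = t} = ENNReal.ofReal (1 / 2) := by
  rw [ENNReal.ofReal_div_of_pos (by norm_num)]
  rcases ht with rfl | rfl
  · simp [h.V_neg j hj]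
  · simp [h.V_pos j hj]

lemma measure_step_eq (h : ν.IsOrderTwo J P) (hj : j ∈ Finset.Icc 1 J)
    {t : (Fin m → ℝ) × (Pairs m → ℝ)} (ht : t ∈ stepValues m) :
    P (ν.step j ⁻¹' {t}) = ENNReal.ofReal (prob t.1) := by
  obtain ⟨hy, hz⟩ := Finset.mem_product.mp ht
  have hset : ν.step j ⁻¹' {t} = ⋂ a ∈ (Finset.univ : Finset (Fin m ⊕ Pairs m)),
      (fun ω => Sum.elim (ν.xi j ω) (ν.V j ω) a) ⁻¹' {Sum.elim t.1 t.2 a} := by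
    ext ω
    simp [Noise.step, Prod.ext_iff, funext_iff]
  have hindep : iIndepFun (fun a ω => Sum.elim (ν.xi j ω) (ν.V j ω) a) P :=
    h.indep.precomp (g := fun a => (⟨j, hj⟩, a)) (Prod.mk_right_injective _)
  rw [hset, hindep.measure_inter_preimage_eq_mul _ fun a _ => measurableSet_singleton _,
    Fintype.prod_sum_type, prob_eq_prod,
    ENNReal.ofReal_mul (Finset.prod_nonneg fun i _ => xiProb_nonneg _),
    ENNReal.ofReal_prod_of_nonneg fun i _ => xiProb_nonneg _, ENNReal.ofReal_pow (by norm_num),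
    ← Finset.card_univ, ← Finset.prod_const]
  congr 1
  · exact Finset.prod_congr rfl fun i _ => h.measure_xi_eq hj i (mem_valuesXi.mp hy i)
  · exact Finset.prod_congr rfl fun p _ => h.measure_V_eq hj p (mem_valuesV.mp hz p)

variable [IsProbabilityMeasure P]

lemma ae_step_mem (h : ν.IsOrderTwo J P) (hj : j ∈ Finset.Icc 1 J) :
    ∀ᵐ ω ∂P, ν.step j ω ∈ stepValues m := by
  have hmeas := h.measurable_step hj (Finset.measurableSet (stepValues m))
  refine (prob_compl_eq_zero_iff hmeas).mpr ?_
  rw [← Measure.map_apply (h.measurable_step hj) (Finset.measurableSet _),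
    ← sum_measure_singleton, ← ENNReal.ofReal_one, ← sum_prob m,
    ENNReal.ofReal_sum_of_nonneg fun t _ => (prob_pos _).le]
  refine Finset.sum_congr rfl fun t ht => ?_
  rw [Measure.map_apply (h.measurable_step hj) (measurableSet_singleton t),
    h.measure_step_eq hj ht]

lemma map_step (h : ν.IsOrderTwo J P) (hj : j ∈ Finset.Icc 1 J) :
    P.map (ν.step j) = stepLaw m := by
  rw [(Measure.ae_mem_finset_iff_map_eq_sum_dirac (h.measurable_step hj).aemeasurable).mp
    (h.ae_step_mem hj)]
  exact Finset.sum_congr rfl fun t ht => by rw [h.measure_step_eq hj ht]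

end Noise.IsOrderTwo

lemma stepLaw_singleton {t : (Fin m → ℝ) × (Pairs m → ℝ)} (ht : t ∈ stepValues m) :
    stepLaw m {t} = ENNReal.ofReal (prob t.1) := by
  rw [stepLaw, Measure.finsetSum_apply, Finset.sum_eq_single_of_mem t ht]
  · simp
  · intro u _ hu
    simp [hu]

instance : IsProbabilityMeasure (stepLaw m) where
  measure_univ := by
    simp [stepLaw, ← ENNReal.ofReal_sum_of_nonneg fun _ _ => (prob_pos _).le, sum_prob]

end NoiseLaw

section Chain

variable {Ω : Type*} {d m s n j : ℕ} (S : Scheme d m) {ν : Noise Ω m}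

lemma Scheme.chainFrom_succ_left (ν : Noise Ω m) (ω : Ω) (s : ℕ) (x : Fin d → ℝ) (n : ℕ) :
    S.chainFrom ν ω s x (n + 1) =
      S.chainFrom ν ω (s + 1) (S.Φ x (ν.xi (s + 1) ω) (ν.V (s + 1) ω)) n := by
  induction n with
  | zero => rfl
  | succ n ih =>
    rw [Scheme.chainFrom, ih, Scheme.chainFrom]
    congr 2 <;> ring

lemma Scheme.path_eq_step (ν : Noise Ω m) (hj : 1 ≤ j) (ω : Ω) :
    S.path ν j ω = S.Φ (S.path ν (j - 1) ω) (ν.xi j ω) (ν.V j ω) := by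
  obtain ⟨i, rfl⟩ := Nat.exists_eq_add_of_le' hj
  simp only [Scheme.path, Scheme.chainFrom, Nat.zero_add, Nat.add_sub_cancel]

lemma Scheme.terminal_pred (ν : Noise Ω m) (hj : j ∈ Finset.Icc 1 S.J) (x : Fin d → ℝ) (ω : Ω) :
    S.terminal ν (j - 1) x ω = S.terminal ν j (S.Φ x (ν.xi j ω) (ν.V j ω)) ω := by
  obtain ⟨h1, hJ⟩ := Finset.mem_Icc.mp hj
  obtain ⟨i, rfl⟩ := Nat.exists_eq_add_of_le' h1
  rw [Scheme.terminal, Scheme.terminal, Nat.add_sub_cancel,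
    show S.J - i = S.J - (i + 1) + 1 by omega, S.chainFrom_succ_left]

variable [MeasurableSpace Ω]

lemma Scheme.measurable_chainFrom
    (h : ∀ i ∈ Finset.Icc (s + 1) (s + n), Measurable (ν.step i)) :
    Measurable fun q : (Fin d → ℝ) × Ω => S.chainFrom ν q.2 s q.1 n := by
  induction n with
  | zero => exact measurable_fst
  | succ n ih =>
    have ih' := ih fun i hi => h i (Finset.Icc_subset_Icc_right (by omega) hi)
    have hstep := h (s + n + 1) (Finset.mem_Icc.mpr ⟨by omega, by omega⟩)
    exact S.measurable_Φ.comp (ih'.prodMk (hstep.comp measurable_snd))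

lemma Scheme.measurable_chainFrom_right (x : Fin d → ℝ)
    (h : ∀ i ∈ Finset.Icc (s + 1) (s + n), Measurable (ν.step i)) :
    Measurable fun ω => S.chainFrom ν ω s x n :=
  (S.measurable_chainFrom h).comp measurable_prodMk_left

lemma Scheme.measurable_path (h : ∀ i ∈ Finset.Icc 1 n, Measurable (ν.step i)) :
    Measurable (S.path ν n) :=
  S.measurable_chainFrom_right S.x₀ (by simpa using h)

variable {J : ℕ} {P : Measure Ω}

namespace Noise.IsOrderTwo

lemma indepFun {α β : Type*} [MeasurableSpace α] [MeasurableSpace β] (h : ν.IsOrderTwo J P)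
    {T T' : Set ℕ} (hT : Disjoint T T') {U : Ω → α} {W : Ω → β}
    (hU : Measurable[ν.sigma J T] U) (hW : Measurable[ν.sigma J T'] W) : IndepFun U W P :=
  (IndepFun_iff_Indep U W P).mpr <| indep_of_indep_of_le_left
    (indep_of_indep_of_le_right (h.indep_sigma hT) hW.comap_le) hU.comap_le

variable {S}

lemma measurable_path (h : ν.IsOrderTwo S.J P) (hj : j ≤ S.J) : Measurable (S.path ν j) :=
  S.measurable_path fun _ hi => h.measurable_step (Finset.Icc_subset_Icc_right hj hi)

lemma measurable_terminal (h : ν.IsOrderTwo S.J P) (hj : j ≤ S.J) :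
    Measurable fun q : (Fin d → ℝ) × Ω => S.terminal ν j q.1 q.2 :=
  S.measurable_chainFrom fun i hi => h.measurable_step <| by
    rw [Finset.mem_Icc] at hi ⊢
    omega

lemma indepFun_path_step (h : ν.IsOrderTwo S.J P) (hj : j ∈ Finset.Icc 1 S.J) :
    IndepFun (S.path ν (j - 1)) (ν.step j) P := by
  have hdisj : Disjoint {i : ℕ | i < j} {j} := by simp
  refine h.indepFun hdisj ?_ (ν.measurable_step_sigma hj rfl)
  let _ := ν.sigma S.J {i | i < j}
  refine S.measurable_path fun i hi => ν.measurable_step_sigma ?_ ?_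
  all_goals
    simp only [Finset.mem_Icc, Set.mem_ofPred_eq] at hi hj ⊢
    omega

lemma indepFun_step_terminal (h : ν.IsOrderTwo S.J P) (hj : j ∈ Finset.Icc 1 S.J)
    (x : Fin d → ℝ) : IndepFun (ν.step j) (S.terminal ν j x) P := by
  have hdisj : Disjoint {j} {i : ℕ | j < i} := by simp
  refine h.indepFun hdisj (ν.measurable_step_sigma hj rfl) ?_
  let _ := ν.sigma S.J {i | j < i}
  refine S.measurable_chainFrom_right x fun i hi => ν.measurable_step_sigma ?_ ?_
  all_goals
    simp only [Finset.mem_Icc, Set.mem_ofPred_eq] at hi hj ⊢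
    omega

variable [IsProbabilityMeasure P]

lemma isProbabilityMeasure_law (h : ν.IsOrderTwo S.J P) (hj : j ≤ S.J) :
    IsProbabilityMeasure (S.law ν P j) :=
  Measure.isProbabilityMeasure_map (h.measurable_path hj).aemeasurable

lemma measurable_h (h : ν.IsOrderTwo S.J P) (hj : j ≤ S.J) (y : Fin m → ℝ) (z : Pairs m → ℝ) :
    Measurable (S.h ν P j y z) := by
  have hq : Measurable (S.q ν P j) :=
    ((S.measurable_f.comp (h.measurable_terminal hj)).stronglyMeasurable.integral_prod_right'
      (ν := P)).measurable
  exact hq.comp (S.measurable_Φ.comp (measurable_id.prodMk (measurable_const (a := (y, z)))))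

lemma map_path_step (h : ν.IsOrderTwo S.J P) (hj : j ∈ Finset.Icc 1 S.J) :
    P.map (fun ω => (S.path ν (j - 1) ω, ν.step j ω)) =
      (S.law ν P (j - 1)).prod (stepLaw m) := by
  have hpath := h.measurable_path (j := j - 1) (by rw [Finset.mem_Icc] at hj; omega)
  rw [← h.map_step hj]
  exact (indepFun_iff_map_prod_eq_prod_map_map hpath.aemeasurable
    (h.measurable_step hj).aemeasurable).mp (h.indepFun_path_step hj)

lemma law_succ (h : ν.IsOrderTwo S.J P) (hj : j + 1 ≤ S.J) :
    S.law ν P (j + 1) =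
      ((S.law ν P j).prod (stepLaw m)).map fun u => S.Φ u.1 u.2.1 u.2.2 := by
  have hmem : j + 1 ∈ Finset.Icc 1 S.J := Finset.mem_Icc.mpr ⟨by omega, hj⟩
  have hjoint := h.map_path_step hmem
  rw [Nat.add_sub_cancel] at hjoint
  rw [← hjoint, Measure.map_map S.measurable_Φ
    ((h.measurable_path (by omega)).prodMk (h.measurable_step hmem)), Scheme.law]
  exact congrArg P.map (funext (S.path_eq_step ν (by omega)))

lemma law_eq {ν' : Noise Ω m} (h : ν.IsOrderTwo S.J P) (h' : ν'.IsOrderTwo S.J P)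
    (hj : j ≤ S.J) : S.law ν P j = S.law ν' P j := by
  induction j with
  | zero => rfl
  | succ j ih => rw [h.law_succ hj, h'.law_succ hj, ih (by omega)]

lemma exists_finset_chainFrom_mem (h : ν.IsOrderTwo S.J P) (hn : s + n ≤ S.J) (x : Fin d → ℝ) :
    ∃ F : Finset (Fin d → ℝ), ∀ᵐ ω ∂P, S.chainFrom ν ω s x n ∈ F := by
  classical
  induction n with
  | zero => exact ⟨{x}, by simp [Scheme.chainFrom]⟩
  | succ n ih =>
    obtain ⟨F, hF⟩ := ih (by omega)
    refine ⟨(F ×ˢ stepValues m).image fun u => S.Φ u.1 u.2.1 u.2.2, ?_⟩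
    filter_upwards [hF, h.ae_step_mem (j := s + n + 1) (Finset.mem_Icc.mpr ⟨by omega, by omega⟩)]
      with ω hchain hstep
    exact Finset.mem_image.mpr ⟨(_, _), Finset.mem_product.mpr ⟨hchain, hstep⟩, rfl⟩

lemma integrable_terminal (h : ν.IsOrderTwo S.J P) (hj : j ≤ S.J) (x : Fin d → ℝ) :
    Integrable (fun ω => S.f (S.terminal ν j x ω)) P := by
  obtain ⟨F, hF⟩ := h.exists_finset_chainFrom_mem (s := j) (n := S.J - j) (by omega) x
  refine Integrable.of_bound (S.measurable_f.comp
    ((h.measurable_terminal hj).comp measurable_prodMk_left)).aestronglyMeasurable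
    (∑ u ∈ F, ‖S.f u‖) ?_
  filter_upwards [hF] with ω hω
  exact Finset.single_le_sum (f := fun u => ‖S.f u‖) (fun _ _ => norm_nonneg _) hω

end Noise.IsOrderTwo

lemma integral_eq_sum_of_indepFun [IsFiniteMeasure P] {T : Type*} [MeasurableSpace T]
    [MeasurableSingletonClass T] {s : Finset T} {U : Ω → T} (hU : Measurable U)
    (hmem : ∀ᵐ ω ∂P, U ω ∈ s) {Y : T → Ω → ℝ} (hY : ∀ t ∈ s, Integrable (Y t) P)
    (hindep : ∀ t ∈ s, IndepFun U (Y t) P) :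
    ∫ ω, Y (U ω) ω ∂P = ∑ t ∈ s, P.real (U ⁻¹' {t}) * ∫ ω, Y t ω ∂P := by
  have hmeas (t : T) : MeasurableSet (U ⁻¹' {t}) := hU (measurableSet_singleton t)
  have hfreeze (t : T) : Set.EqOn (fun ω => Y (U ω) ω) (Y t) (U ⁻¹' {t}) := by
    rintro ω rfl
    rfl
  have hcover : (⋃ t ∈ s, U ⁻¹' {t}) =ᵐ[P] Set.univ := by
    filter_upwards [hmem] with ω hω
    exact eq_true (Set.mem_biUnion (x := U ω) hω rfl)
  rw [← setIntegral_univ, ← setIntegral_congr_set hcover, integral_biUnion_finset s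
    (fun t _ => hmeas t) (fun t _ u _ htu => .preimage U (Set.disjoint_singleton.mpr htu))
    fun t ht => (hY t ht).integrableOn.congr_fun (hfreeze t).symm (hmeas t)]
  refine Finset.sum_congr rfl fun t ht => ?_
  rw [setIntegral_congr_fun (hmeas t) (hfreeze t)]
  exact Indep.setIntegral_eq_mul (f := id) hU.comap_le
    ((IndepFun_iff_Indep _ _ _).mp (hindep t ht)) (hY t ht).aemeasurable
    ⟨{t}, measurableSet_singleton t, rfl⟩ aestronglyMeasurable_id

/-- The coefficient of `h_{j,y,z}` in `a_{j,o,r}` and of its estimate in `aEstimate`, for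
`t = (y, z)`. -/
def stepWeight (o : Fin m → Fin 3) (r : Pairs m → Fin 2) (t : (Fin m → ℝ) × (Pairs m → ℝ)) : ℝ :=
  prob t.1 * hermiteProd o t.1 * signProd r t.2

lemma Noise.IsOrderTwo.a_eq_sum {S : Scheme d m} [IsProbabilityMeasure P] (h : ν.IsOrderTwo S.J P)
    (hj : j ∈ Finset.Icc 1 S.J) (o : Fin m → Fin 3) (r : Pairs m → Fin 2) (x : Fin d → ℝ) :
    S.a ν P j o r x = ∑ t ∈ stepValues m, stepWeight o r t * S.h ν P j t.1 t.2 x := by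
  have hjJ := (Finset.mem_Icc.mp hj).2
  let Y (t : (Fin m → ℝ) × (Pairs m → ℝ)) (ω : Ω) : ℝ :=
    S.f (S.terminal ν j (S.Φ x t.1 t.2) ω) * (hermiteProd o t.1 * signProd r t.2)
  calc S.a ν P j o r x = ∫ ω, Y (ν.step j ω) ω ∂P := by
        simp only [Scheme.a, S.terminal_pred ν hj, mul_assoc, Y, Noise.step]
    _ = ∑ t ∈ stepValues m, P.real (ν.step j ⁻¹' {t}) * ∫ ω, Y t ω ∂P :=
        integral_eq_sum_of_indepFun (h.measurable_step hj) (h.ae_step_mem hj)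
          (fun t _ => (h.integrable_terminal hjJ _).mul_const _)
          fun t _ => (h.indepFun_step_terminal hj _).comp measurable_id
            (S.measurable_f.mul_const (hermiteProd o t.1 * signProd r t.2))
    _ = _ := Finset.sum_congr rfl fun t ht => by
        rw [measureReal_def, h.measure_step_eq hj ht, ENNReal.toReal_ofReal (prob_pos _).le,
          integral_mul_const, stepWeight, Scheme.h, Scheme.q]
        ring

end Chain

section Training

variable {Ω : Type*} [MeasurableSpace Ω] {P : Measure Ω} {d m J K N j : ℕ} (S : Scheme d m)
  {ν : Noise Ω m} {τ : Fin N → Noise Ω m}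

lemma Scheme.residual_eq_rss (ν : Noise Ω m) (P : Measure Ω) (ψ : Fin K → (Fin d → ℝ) → ℝ)
    (τ : Fin N → Noise Ω m) (hj : 1 ≤ j) (y : Fin m → ℝ) (z : Pairs m → ℝ) (ω : Ω)
    (β : Fin K → ℝ) :
    S.residual ν P ψ τ j y z ω β = rss (fun n => stratumPoint ψ (S.h ν P j y z) (y, z)
      (S.path (τ n) (j - 1) ω, (τ n).step j ω)) β := by
  classical
  rw [Scheme.residual, stratum, Finset.sum_filter, rss]
  refine Finset.sum_congr rfl fun n _ => ?_
  by_cases hn : (τ n).xi j ω = y ∧ (τ n).V j ω = z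
  · rw [if_pos hn, stratumPoint, if_pos (Prod.ext hn.1 hn.2), S.path_eq_step _ hj, hn.1, hn.2]
    rfl
  · rw [if_neg hn, stratumPoint, if_neg fun h => hn (Prod.ext_iff.mp h)]
    simp

lemma IsTraining.iIndepFun_path_step (hτ : IsTraining τ J P) (hj : j ∈ Finset.Icc 1 J) :
    iIndepFun (fun n ω => (S.path (τ n) (j - 1) ω, (τ n).step j ω)) P := by
  rw [iIndepFun_iff_iIndep]
  refine iIndep_of_iIndep_of_le hτ.indep.iIndep fun n => Measurable.comap_le ?_
  let noise (ω : Ω) (i : Finset.Icc 1 J) := ((τ n).xi i ω, (τ n).V i ω)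
  let _ := MeasurableSpace.comap noise inferInstance
  have hstep (i : ℕ) (hi : i ∈ Finset.Icc 1 J) : Measurable ((τ n).step i) :=
    (measurable_pi_apply (⟨i, hi⟩ : Finset.Icc 1 J)).comp (comap_measurable noise)
  refine (S.measurable_path fun i hi => hstep i ?_).prodMk (hstep j hj)
  rw [Finset.mem_Icc] at hi hj ⊢
  omega

variable {S}

lemma lintegral_sq_regression_sub_h_le [IsProbabilityMeasure P] (hν : ν.IsOrderTwo S.J P)
    (hτ : IsTraining τ S.J P) {ψ : Fin K → (Fin d → ℝ) → ℝ} (hψ : ∀ k, Measurable (ψ k)) {A : ℝ}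
    (hA : S.Bounded ν P A) {α : ℕ → (Fin m → ℝ) → (Pairs m → ℝ) → Ω → Fin K → ℝ}
    (hα : S.IsRegression ν P ψ τ α) (hj : j ∈ Finset.Icc 1 S.J)
    {t : (Fin m → ℝ) × (Pairs m → ℝ)} (ht : t ∈ stepValues m) :
    ∫⁻ ω, ∫⁻ x, ENNReal.ofReal
        ((truncate A (linComb ψ (α j t.1 t.2 ω) x) - S.h ν P j t.1 t.2 x) ^ 2)
        ∂(S.law ν P (j - 1)) ∂P ≤
      4 * (⨅ g ∈ Submodule.span ℝ (Set.range ψ),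
        ∫⁻ x, ENNReal.ofReal ((S.h ν P j t.1 t.2 x - g x) ^ 2) ∂(S.law ν P (j - 1))) +
        ENNReal.ofReal (8 * A ^ 2 * K / (N + 1) / prob t.1) := by
  obtain ⟨hy, hz⟩ := Finset.mem_product.mp ht
  obtain ⟨h1, hJ⟩ := Finset.mem_Icc.mp hj
  have hpred : j - 1 ≤ S.J := by omega
  have := hν.isProbabilityMeasure_law hpred
  have hlaw (n : Fin N) : P.map (fun ω => (S.path (τ n) (j - 1) ω, (τ n).step j ω)) =
      (S.law ν P (j - 1)).prod (stepLaw m) := by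
    rw [(hτ.isOrderTwo n).map_path_step hj, (hτ.isOrderTwo n).law_eq hν hpred]
  have hlsq : ∀ᵐ ω ∂P, IsLeastSquares (fun n => stratumPoint ψ (S.h ν P j t.1 t.2) t
      (S.path (τ n) (j - 1) ω, (τ n).step j ω)) (α j t.1 t.2 ω) := by
    filter_upwards [(hα j hj t.1 hy t.2 hz).2] with ω hω β
    simpa only [S.residual_eq_rss ν P ψ τ h1] using hω β
  have hp : 0 < prob t.1 := prob_pos t.1
  have hrisk := lintegral_stratum_le hψ (hν.measurable_h hJ t.1 t.2) (hA j hj t.1 hy t.2 hz)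
    (by simpa [stepLaw_singleton ht] using hp)
    (fun n => ((hτ.isOrderTwo n).measurable_path hpred).prodMk
      ((hτ.isOrderTwo n).measurable_step hj))
    (hτ.iIndepFun_path_step S hj) hlaw hlsq
  rw [ENNReal.ofReal_div_of_pos hp, ENNReal.ofReal_div_of_pos (by positivity),
    ENNReal.ofReal_add N.cast_nonneg zero_le_one, ENNReal.ofReal_natCast, ENNReal.ofReal_one,
    ← stepLaw_singleton ht]
  rwa [Fintype.card_fin] at hrisk

end Training

section WeightedSum

variable {m : ℕ}

lemma lintegral_sq_sum_mul_le {X T : Type*} [MeasurableSpace X] {μ : Measure X} (s : Finset T)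
    (w : T → ℝ) {e : T → X → ℝ} (he : ∀ t ∈ s, Measurable (e t)) :
    ∫⁻ x, ENNReal.ofReal ((∑ t ∈ s, w t * e t x) ^ 2) ∂μ ≤
      ∑ t ∈ s, ENNReal.ofReal (s.card * w t ^ 2) * ∫⁻ x, ENNReal.ofReal (e t x ^ 2) ∂μ := by
  calc ∫⁻ x, ENNReal.ofReal ((∑ t ∈ s, w t * e t x) ^ 2) ∂μ
      ≤ ∫⁻ x, ∑ t ∈ s, ENNReal.ofReal (s.card * w t ^ 2) * ENNReal.ofReal (e t x ^ 2) ∂μ := by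
        refine lintegral_mono fun x => ?_
        simp only [← ENNReal.ofReal_mul (mul_nonneg (Nat.cast_nonneg s.card) (sq_nonneg (w _)))]
        rw [← ENNReal.ofReal_sum_of_nonneg fun t _ => by positivity]
        refine ENNReal.ofReal_le_ofReal (sq_sum_le_card_mul_sum_sq.trans_eq ?_)
        rw [Finset.mul_sum]
        exact Finset.sum_congr rfl fun t _ => by ring
    _ = ∑ t ∈ s, ENNReal.ofReal (s.card * w t ^ 2) * ∫⁻ x, ENNReal.ofReal (e t x ^ 2) ∂μ := by
        rw [lintegral_finsetSum s fun t ht =>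
          (((he t ht).pow_const 2).ennreal_ofReal).const_mul _]
        exact Finset.sum_congr rfl fun t _ => lintegral_const_mul' _ _ ENNReal.ofReal_ne_top

lemma cConst_nonneg (m : ℕ) : 0 ≤ cConst m := by
  unfold cConst
  positivity

lemma cConstO_nonneg (o : Fin m → Fin 3) : 0 ≤ cConstO o :=
  Finset.sum_nonneg fun _ _ => mul_nonneg (mul_nonneg (cConst_nonneg m) (by positivity))
    (sq_nonneg _)

lemma sq_stepWeight (o : Fin m → Fin 3) (r : Pairs m → Fin 2)
    {t : (Fin m → ℝ) × (Pairs m → ℝ)} (ht : t ∈ stepValues m) :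
    stepWeight o r t ^ 2 = (prob t.1 * hermiteProd o t.1) ^ 2 := by
  rw [stepWeight, mul_pow, sq_signProd r (Finset.mem_product.mp ht).2, mul_one]

lemma sum_sq_stepWeight (o : Fin m → Fin 3) (r : Pairs m → Fin 2) :
    ∑ t ∈ stepValues m, cConst m * stepWeight o r t ^ 2 = cConstO o := by
  rw [Finset.sum_congr rfl fun t ht => by rw [sq_stepWeight o r ht], Finset.sum_product, cConstO]
  refine Finset.sum_congr rfl fun y _ => ?_
  simp only [Finset.sum_const, card_valuesV, nsmul_eq_mul]
  push_cast
  ring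

lemma sum_sq_stepWeight_div_prob (o : Fin m → Fin 3) (r : Pairs m → Fin 2) :
    ∑ t ∈ stepValues m, stepWeight o r t ^ 2 / prob t.1 = 1 := by
  rw [← sum_prob_mul_sq_hermiteProd o]
  refine Finset.sum_congr rfl fun t ht => ?_
  have hp := (prob_pos t.1).ne'
  rw [sq_stepWeight o r ht]
  field_simp

lemma sum_sq_stepWeight_mul_add_div (o : Fin m → Fin 3) (r : Pairs m → Fin 2) (a b : ℝ) :
    ∑ t ∈ stepValues m, cConst m * stepWeight o r t ^ 2 * (a + b / prob t.1) =
      cConst m * b + a * cConstO o := by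
  rw [← sum_sq_stepWeight o r, ← mul_one (cConst m * b), ← sum_sq_stepWeight_div_prob o r,
    Finset.mul_sum, Finset.mul_sum, ← Finset.sum_add_distrib]
  exact Finset.sum_congr rfl fun t _ => by ring

end WeightedSum

section Estimate

variable {Ω : Type*} [MeasurableSpace Ω] {P : Measure Ω} [IsProbabilityMeasure P] {d m K N j : ℕ}
  {S : Scheme d m} {ν : Noise Ω m} {τ : Fin N → Noise Ω m} {ψ : Fin K → (Fin d → ℝ) → ℝ}
  {α : ℕ → (Fin m → ℝ) → (Pairs m → ℝ) → Ω → Fin K → ℝ}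

lemma aEstimate_sub_a (hν : ν.IsOrderTwo S.J P) (hj : j ∈ Finset.Icc 1 S.J) (A : ℝ)
    (ψ : Fin K → (Fin d → ℝ) → ℝ) (α : ℕ → (Fin m → ℝ) → (Pairs m → ℝ) → Ω → Fin K → ℝ)
    (o : Fin m → Fin 3) (r : Pairs m → Fin 2) (ω : Ω) (x : Fin d → ℝ) :
    aEstimate A ψ α j o r ω x - S.a ν P j o r x = ∑ t ∈ stepValues m, stepWeight o r t *
      (truncate A (linComb ψ (α j t.1 t.2 ω) x) - S.h ν P j t.1 t.2 x) := by
  simp only [hν.a_eq_sum hj, aEstimate, mul_sub, Finset.sum_sub_distrib, Finset.sum_product,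
    stepWeight]

lemma measurable_regression_sub_h (hν : ν.IsOrderTwo S.J P) (hψ : ∀ k, Measurable (ψ k)) (A : ℝ)
    (hα : S.IsRegression ν P ψ τ α) (hj : j ∈ Finset.Icc 1 S.J)
    {t : (Fin m → ℝ) × (Pairs m → ℝ)} (ht : t ∈ stepValues m) :
    Measurable fun q : Ω × (Fin d → ℝ) =>
      truncate A (linComb ψ (α j t.1 t.2 q.1) q.2) - S.h ν P j t.1 t.2 q.2 := by
  obtain ⟨hy, hz⟩ := Finset.mem_product.mp ht
  have hαm := (hα j hj t.1 hy t.2 hz).1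
  have hh := hν.measurable_h (Finset.mem_Icc.mp hj).2 t.1 t.2
  unfold linComb
  fun_prop

lemma lintegral_sq_aEstimate_sub_a_le (hν : ν.IsOrderTwo S.J P) (hψ : ∀ k, Measurable (ψ k))
    (A : ℝ) (hα : S.IsRegression ν P ψ τ α) (hj : j ∈ Finset.Icc 1 S.J) (o : Fin m → Fin 3)
    (r : Pairs m → Fin 2) :
    ∫⁻ ω, ∫⁻ x, ENNReal.ofReal ((aEstimate A ψ α j o r ω x - S.a ν P j o r x) ^ 2)
        ∂(S.law ν P (j - 1)) ∂P ≤
      ∑ t ∈ stepValues m, ENNReal.ofReal (cConst m * stepWeight o r t ^ 2) *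
        ∫⁻ ω, ∫⁻ x, ENNReal.ofReal
          ((truncate A (linComb ψ (α j t.1 t.2 ω) x) - S.h ν P j t.1 t.2 x) ^ 2)
          ∂(S.law ν P (j - 1)) ∂P := by
  have := hν.isProbabilityMeasure_law (j := j - 1) (by rw [Finset.mem_Icc] at hj; omega)
  have herror := fun t (ht : t ∈ stepValues m) => measurable_regression_sub_h hν hψ A hα hj ht
  have hiterated (t) (ht : t ∈ stepValues m) :=
    lintegral_prod (μ := P) (ν := S.law ν P (j - 1)) _
      ((herror t ht).pow_const 2).ennreal_ofReal.aemeasurable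
  simp only [aEstimate_sub_a hν hj]
  rw [← Finset.sum_congr rfl fun t ht => congrArg (_ * ·) (hiterated t ht), ← card_stepValues]
  refine le_of_eq_of_le ?_ (lintegral_sq_sum_mul_le _ (stepWeight o r) herror)
  exact (lintegral_prod _ ((Finset.measurable_sum _ fun t ht =>
    (herror t ht).const_mul _).pow_const 2).ennreal_ofReal.aemeasurable).symm

end Estimate

lemma rate_le_log_rate {m N K : ℕ} (hN : 1 ≤ N) (A : ℝ) {ε : ℝ} (hε : 0 ≤ ε)
    (o : Fin m → Fin 3) :
    cConst m * (8 * A ^ 2 * K / (N + 1)) + 4 * ε * cConstO o ≤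
      cConst m * 8 * A ^ 2 * (Real.log N + 1) * (K / N) + 8 * ε * cConstO o := by
  have hc := cConst_nonneg m
  have hcO := cConstO_nonneg o
  have hlog : 1 ≤ Real.log N + 1 := le_add_of_nonneg_left (Real.log_natCast_nonneg N)
  have hrate : (K : ℝ) / (N + 1) ≤ (Real.log N + 1) * (K / N) :=
    (div_le_div_of_nonneg_left K.cast_nonneg (by positivity) (by linarith)).trans
      (le_mul_of_one_le_left (by positivity) hlog)
  calc _ = cConst m * 8 * A ^ 2 * (K / (N + 1)) + 4 * ε * cConstO o := by ring
    _ ≤ cConst m * 8 * A ^ 2 * ((Real.log N + 1) * (K / N)) + 8 * ε * cConstO o := by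
        gcongr
        norm_num
    _ = _ := by ring

end

end SRCV

theorem lemma2_general {Ω : Type*} [MeasurableSpace Ω] {P : Measure Ω} [IsProbabilityMeasure P]
    {d m N K : ℕ} {S : SRCV.Scheme d m} {ν : SRCV.Noise Ω m} (hν : ν.IsOrderTwo S.J P)
    {τ : Fin N → SRCV.Noise Ω m} (hτ : SRCV.IsTraining τ S.J P)
    {ψ : Fin K → (Fin d → ℝ) → ℝ} (hψ : ∀ k, Measurable (ψ k))
    {A : ℝ} (hA : S.Bounded ν P A)
    {α : ℕ → (Fin m → ℝ) → (SRCV.Pairs m → ℝ) → Ω → Fin K → ℝ} (hα : S.IsRegression ν P ψ τ α)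
    {j : ℕ} (hj : j ∈ Finset.Icc 1 S.J) {ε : ℝ} (hε : 0 ≤ ε)
    (happrox : ∀ y ∈ SRCV.valuesXi m, ∀ z ∈ SRCV.valuesV m,
      ⨅ g ∈ Submodule.span ℝ (Set.range ψ),
          ∫⁻ x, ENNReal.ofReal ((S.h ν P j y z x - g x) ^ 2) ∂(S.law ν P (j - 1))
        ≤ ENNReal.ofReal ε)
    (o : Fin m → Fin 3) (r : SRCV.Pairs m → Fin 2) :
    ∫⁻ ω, ∫⁻ x, ENNReal.ofReal ((SRCV.aEstimate A ψ α j o r ω x - S.a ν P j o r x) ^ 2)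
        ∂(S.law ν P (j - 1)) ∂P
      ≤ ENNReal.ofReal
        (SRCV.cConst m * (8 * A ^ 2 * K / (N + 1)) + 4 * ε * SRCV.cConstO o) := by
  have hrisk : ∀ t ∈ SRCV.stepValues m,
      ∫⁻ ω, ∫⁻ x, ENNReal.ofReal ((SRCV.truncate A (SRCV.linComb ψ (α j t.1 t.2 ω) x) -
          S.h ν P j t.1 t.2 x) ^ 2) ∂(S.law ν P (j - 1)) ∂P ≤
        ENNReal.ofReal (4 * ε + 8 * A ^ 2 * K / (N + 1) / SRCV.prob t.1) := fun t ht => by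
    obtain ⟨hy, hz⟩ := Finset.mem_product.mp ht
    have hp := SRCV.prob_pos t.1
    rw [ENNReal.ofReal_add (by positivity) (by positivity), ENNReal.ofReal_mul (by norm_num),
      ENNReal.ofReal_ofNat]
    refine (SRCV.lintegral_sq_regression_sub_h_le hν hτ hψ hA hα hj ht).trans ?_
    gcongr
    exact happrox t.1 hy t.2 hz
  have hc := SRCV.cConst_nonneg m
  calc _ ≤ _ := SRCV.lintegral_sq_aEstimate_sub_a_le hν hψ A hα hj o r
    _ ≤ ∑ t ∈ SRCV.stepValues m, ENNReal.ofReal (SRCV.cConst m * SRCV.stepWeight o r t ^ 2) *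
          ENNReal.ofReal (4 * ε + 8 * A ^ 2 * K / (N + 1) / SRCV.prob t.1) := by
        gcongr with t ht
        exact hrisk t ht
    _ = ENNReal.ofReal (∑ t ∈ SRCV.stepValues m, SRCV.cConst m * SRCV.stepWeight o r t ^ 2 *
          (4 * ε + 8 * A ^ 2 * K / (N + 1) / SRCV.prob t.1)) := by
        rw [ENNReal.ofReal_sum_of_nonneg fun t _ => by have := SRCV.prob_pos t.1; positivity]
        simp only [ENNReal.ofReal_mul (mul_nonneg hc (sq_nonneg (SRCV.stepWeight o r _)))]
    _ = _ := by rw [SRCV.sum_sq_stepWeight_mul_add_div]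

theorem lemma2 :
    ∃ c : ℝ, 0 < c ∧
      ∀ (Ω : Type*) [MeasurableSpace Ω] (P : Measure Ω) [IsProbabilityMeasure P]
        (d m : ℕ) (S : SRCV.Scheme d m)
        (ν : SRCV.Noise Ω m) (_ : ν.IsOrderTwo S.J P)
        (N : ℕ) (_ : 1 ≤ N) (τ : Fin N → SRCV.Noise Ω m) (_ : SRCV.IsTraining τ S.J P)
        (K : ℕ) (_ : 1 ≤ K) (ψ : Fin K → (Fin d → ℝ) → ℝ) (_ : ∀ k, Measurable (ψ k))
        (A : ℝ) (_ : 0 < A) (_ : S.Bounded ν P A)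
        (κ C : ℝ) (_ : 0 < κ) (_ : 0 < C) (_ : S.WellApproximated ν P ψ C κ)
        (α : ℕ → (Fin m → ℝ) → (SRCV.Pairs m → ℝ) → Ω → Fin K → ℝ)
        (_ : S.IsRegression ν P ψ τ α),
        ∀ j ∈ Finset.Icc 1 S.J, ∀ (o : Fin m → Fin 3) (r : SRCV.Pairs m → Fin 2),
          (o, r) ∈ SRCV.indexU m →
          ∫⁻ ω, ∫⁻ x, ENNReal.ofReal
              ((SRCV.aEstimate A ψ α j o r ω x - S.a ν P j o r x) ^ 2)
              ∂(S.law ν P (j - 1)) ∂P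
            ≤ ENNReal.ofReal
              (SRCV.cConst m * c * A ^ 2 * (Real.log N + 1) * (K / N)
                + 8 * C / (K : ℝ) ^ κ * SRCV.cConstO o) := by
  refine ⟨8, by norm_num, ?_⟩
  intro Ω _ P _ d m S ν hν N hN τ hτ K _ ψ hψ A _ hA κ C _ hC happrox α hα j hj o r _
  have hε : 0 ≤ C / (K : ℝ) ^ κ := by positivity
  rw [mul_div_assoc 8 C]
  exact (lemma2_general hν hτ hψ hA hα hj hε (happrox j hj) o r).trans
    (ENNReal.ofReal_le_ofReal (SRCV.rate_le_log_rate hN A hε o))
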